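/- **Lemma.** For a domain $D\subset\mathbb C^d$ let $K_D$ denote the Kobayashi pseudodistance. $D$ is *complete hyperbolic* if $(D,K_D)$ is a complete metric space; in that case it is *Gromov hyperbolic* if there is $\delta>0$ such that every geodesic triangle for $K_D$ is $\delta$-thin, i.e. each point of a side is at $K_D$-distance at most $\delta$ from the union of the other two sides. A couple of distinct points $q_1,q_2\in\partial D$ (Euclidean boundary) satisfies the *visibility condition with respect to $K_D$* if there are disjoint neighborhoods $N_1$ of $q_1$ and $N_2$ of $q_2$ and a compact set $K\subset D$ such that every $K_D$-geodesic segment joining a point of $N_1\cap D$ to a point of $N_2\cap D$ meets $K$. A bounded domain $\Omega\subset\mathbb C^d$ is *locally visible at $p\in\partial\Omega$* if there is an open neighborhood $V$ of $p$ such that $\Omega\cap V$ is connected and complete hyperbolic, and an open neighborhood $V'\subseteq V$ of $p$ such that every two distinct points $q_1,q_2\in\partial\Omega\cap V'$ satisfy the visibility condition with respect to $K_{\Omega\cap V}$; we then call $V$ a *visibility neighborhood* of $p$ for $\Omega$. Let $\Omega\subset\mathbb C^d$ be a bounded domain, $p\in\partial\Omega$, and let $U$ be an open neighborhood of $p$ such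 that $U\cap\Omega$ is connected, complete hyperbolic and Gromov hyperbolic. If $\Omega$ is locally visible at $p$, then $U\cap\Omega$ is also locally visible at $p$. More precisely, $U$ itself is a visibility neighborhood of $p$ for $\Omega$: there is an open neighborhood $U'\subseteq U$ of $p$ such that every two distinct points of $\partial\Omega\cap U'$ satisfy the visibility condition with respect to $K_{U\cap\Omega}$. -/

import Mathlib

open Set Topology
open scoped ENNReal

/-- The Poincaré distance of the unit disc of `ℂ`:
`ρ(a, b) = artanh |(a - b) / (1 - conj a * b)|`. -/
noncomputable def poincareDist (a b : ℂ) : ℝ :=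
  Real.artanh ‖(a - b) / (1 - (starRingEnd ℂ) a * b)‖

/-- The Lempert function of `Ω ⊆ ℂ^d`: the infimum of `ρ(a, b)` over all holomorphic discs
`f : 𝔻 → Ω` and `a, b ∈ 𝔻` with `f a = x`, `f b = y` (and `∞` if there is no such disc). -/
noncomputable def lempertFunction {d : ℕ} (Ω : Set (EuclideanSpace ℂ (Fin d)))
    (x y : EuclideanSpace ℂ (Fin d)) : ℝ≥0∞ :=
  ⨅ (f : ℂ → EuclideanSpace ℂ (Fin d)) (a : ℂ) (b : ℂ)
    (_ : DifferentiableOn ℂ f (Metric.ball 0 1) ∧ MapsTo f (Metric.ball 0 1) Ω ∧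
      a ∈ Metric.ball (0 : ℂ) 1 ∧ b ∈ Metric.ball (0 : ℂ) 1 ∧ f a = x ∧ f b = y),
    ENNReal.ofReal (poincareDist a b)

/-- The Kobayashi pseudodistance `K_Ω(x, y)`: the infimum, over all finite chains of points from
`x` to `y`, of the sums of the Lempert function over the links of the chain, i.e. the infimum of
the total Poincaré length of chains of holomorphic discs in `Ω` from `x` to `y`.
It is finite on a connected open set. -/
noncomputable def kobayashiEDist {d : ℕ} (Ω : Set (EuclideanSpace ℂ (Fin d)))
    (x y : EuclideanSpace ℂ (Fin d)) : ℝ≥0∞ :=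
  ⨅ (n : ℕ) (z : ℕ → EuclideanSpace ℂ (Fin d)) (_ : z 0 = x ∧ z n = y),
    ∑ i ∈ Finset.range n, lempertFunction Ω (z i) (z (i + 1))

theorem poincareDist_comm (a b : ℂ) : poincareDist a b = poincareDist b a := by
  have h : ‖1 - (starRingEnd ℂ) a * b‖ = ‖1 - (starRingEnd ℂ) b * a‖ := by
    rw [← Complex.norm_conj (1 - (starRingEnd ℂ) a * b)]
    simp [mul_comm]
  simp only [poincareDist, norm_div, h, norm_sub_rev a b]

theorem lempertFunction_comm {d : ℕ} (Ω : Set (EuclideanSpace ℂ (Fin d)))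
    (x y : EuclideanSpace ℂ (Fin d)) : lempertFunction Ω x y = lempertFunction Ω y x := by
  have key : ∀ x y, lempertFunction Ω x y ≤ lempertFunction Ω y x := by
    intro x y
    unfold lempertFunction
    refine le_iInf fun f => le_iInf fun a => le_iInf fun b => le_iInf fun h => ?_
    obtain ⟨h1, h2, h3, h4, h5, h6⟩ := h
    rw [poincareDist_comm a b]
    exact iInf_le_of_le f (iInf_le_of_le b (iInf_le_of_le a
      (iInf_le_of_le ⟨h1, h2, h4, h3, h6, h5⟩ le_rfl)))
  exact le_antisymm (key x y) (key y x)

theorem kobayashiEDist_self {d : ℕ} (Ω : Set (EuclideanSpace ℂ (Fin d)))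
    (x : EuclideanSpace ℂ (Fin d)) : kobayashiEDist Ω x x = 0 := by
  refine le_antisymm ?_ bot_le
  exact iInf_le_of_le 0 (iInf_le_of_le (fun _ => x) (iInf_le_of_le ⟨rfl, rfl⟩ (by simp)))

theorem kobayashiEDist_comm {d : ℕ} (Ω : Set (EuclideanSpace ℂ (Fin d)))
    (x y : EuclideanSpace ℂ (Fin d)) : kobayashiEDist Ω x y = kobayashiEDist Ω y x := by
  have key : ∀ x y, kobayashiEDist Ω x y ≤ kobayashiEDist Ω y x := by
    intro x y
    refine le_iInf fun n => le_iInf fun z => le_iInf fun h => ?_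
    refine iInf_le_of_le n (iInf_le_of_le (fun i => z (n - i)) (iInf_le_of_le ?_ ?_))
    · simp [h.1, h.2]
    · rw [← Finset.sum_range_reflect]
      refine Finset.sum_le_sum fun i hi => ?_
      have hi' := Finset.mem_range.1 hi
      have e1 : n - (n - 1 - i) = i + 1 := by omega
      have e2 : n - (n - 1 - i + 1) = i := by omega
      simp only [e1, e2]
      rw [lempertFunction_comm]
  exact le_antisymm (key x y) (key y x)

theorem kobayashiEDist_triangle {d : ℕ} (Ω : Set (EuclideanSpace ℂ (Fin d)))
    (x y w : EuclideanSpace ℂ (Fin d)) :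
    kobayashiEDist Ω x w ≤ kobayashiEDist Ω x y + kobayashiEDist Ω y w := by
  refine ENNReal.le_of_forall_pos_le_add fun ε hε hfin => ?_
  have hε2 : (0 : ℝ≥0∞) < ε / 2 := by
    simpa using hε.ne'
  have h1 : kobayashiEDist Ω x y < kobayashiEDist Ω x y + ε / 2 :=
    ENNReal.lt_add_right (ne_top_of_le_ne_top hfin.ne le_self_add) hε2.ne'
  have h2 : kobayashiEDist Ω y w < kobayashiEDist Ω y w + ε / 2 :=
    ENNReal.lt_add_right (ne_top_of_le_ne_top hfin.ne le_add_self) hε2.ne'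
  conv_lhs at h1 => unfold kobayashiEDist
  conv_lhs at h2 => unfold kobayashiEDist
  simp only [iInf_lt_iff] at h1 h2
  obtain ⟨n, z, ⟨hz0, hzn⟩, hz⟩ := h1
  obtain ⟨m, u, ⟨hu0, hum⟩, hu⟩ := h2
  have hle : kobayashiEDist Ω x w ≤
      (∑ i ∈ Finset.range n, lempertFunction Ω (z i) (z (i + 1))) +
        ∑ i ∈ Finset.range m, lempertFunction Ω (u i) (u (i + 1)) := by
    refine iInf_le_of_le (n + m) (iInf_le_of_le
      (fun i => if i ≤ n then z i else u (i - n)) (iInf_le_of_le ?_ ?_))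
    · refine ⟨by simp [hz0], ?_⟩
      by_cases hm : m = 0
      · subst hm
        simp [hzn, ← hum, hu0]
      · have : ¬ (n + m ≤ n) := by omega
        simp [hum, hm]
    · rw [Finset.sum_range_add]
      refine add_le_add (Finset.sum_le_sum fun i hi => ?_) (Finset.sum_le_sum fun i hi => ?_)
      · have hi' := Finset.mem_range.1 hi
        simp [hi'.le, Nat.succ_le_of_lt hi']
      · have e1 : ¬ (n + i + 1 ≤ n) := by omega
        have e2 : n + i + 1 - n = i + 1 := by omega
        have e3 : (if n + i ≤ n then z (n + i) else u (n + i - n)) = u i := by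
          by_cases h0 : i = 0
          · subst h0
            simp [hzn, hu0]
          · have : ¬ (n + i ≤ n) := by omega
            simp [h0]
        simp only [e1, e2, e3, if_false, le_refl]
  calc kobayashiEDist Ω x w ≤ _ := hle
    _ ≤ (kobayashiEDist Ω x y + ε / 2) + (kobayashiEDist Ω y w + ε / 2) :=
        add_le_add hz.le hu.le
    _ = kobayashiEDist Ω x y + kobayashiEDist Ω y w + (ε / 2 + ε / 2) := by ring
    _ = kobayashiEDist Ω x y + kobayashiEDist Ω y w + ε := by rw [ENNReal.add_halves]

/-- The set `Ω`, regarded as the space `(Ω, K_Ω)`. -/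
@[ext]
structure KobayashiSpace {d : ℕ} (Ω : Set (EuclideanSpace ℂ (Fin d))) where
  /-- the underlying point of `ℂ^d` -/
  pt : EuclideanSpace ℂ (Fin d)
  mem : pt ∈ Ω

noncomputable instance KobayashiSpace.instPseudoEMetricSpace {d : ℕ}
    (Ω : Set (EuclideanSpace ℂ (Fin d))) : PseudoEMetricSpace (KobayashiSpace Ω) where
  edist x y := kobayashiEDist Ω x.pt y.pt
  edist_self x := kobayashiEDist_self Ω x.pt
  edist_comm x y := kobayashiEDist_comm Ω x.pt y.pt
  edist_triangle x y z := kobayashiEDist_triangle Ω x.pt y.pt z.pt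

/-- `Ω` is complete hyperbolic: `K_Ω` separates the points of `Ω` and `(Ω, K_Ω)` is complete. -/
def IsCompleteHyperbolic {d : ℕ} (Ω : Set (EuclideanSpace ℂ (Fin d))) : Prop :=
  (∀ x y : KobayashiSpace Ω, edist x y = 0 → x = y) ∧ CompleteSpace (KobayashiSpace Ω)

/-- `S` is a geodesic segment `[x, y]`: the image of an isometric embedding of an interval
`[0, L]` that sends `0` to `x` and `L` to `y`. -/
def IsGeodesicSegment {X : Type*} [PseudoEMetricSpace X] (S : Set X) (x y : X) : Prop :=
  ∃ (L : ℝ) (γ : ℝ → X), 0 ≤ L ∧ γ 0 = x ∧ γ L = y ∧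
    (∀ s ∈ Icc 0 L, ∀ t ∈ Icc 0 L, edist (γ s) (γ t) = ENNReal.ofReal |s - t|) ∧
    S = γ '' Icc 0 L

/-- Gromov hyperbolicity of a geodesic space: there is `δ > 0` such that all geodesic triangles
are `δ`-thin, i.e. every point of a side is within `δ` of the union of the other two sides.
(The roles of the three sides are interchangeable, so it is enough to speak of one of them.) -/
def IsGromovHyperbolic (X : Type*) [PseudoEMetricSpace X] : Prop :=
  ∃ δ : ℝ, 0 < δ ∧ ∀ (x y z : X) (S₁ S₂ S₃ : Set X),
    IsGeodesicSegment S₁ x y → IsGeodesicSegment S₂ y z → IsGeodesicSegment S₃ z x →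
      ∀ a ∈ S₁, Metric.infEDist a (S₂ ∪ S₃) ≤ ENNReal.ofReal δ

/-- The couple `(p, q)` has the visibility condition with respect to the geodesics of `K_D`:
there are disjoint neighborhoods of `p` and `q` and a compact subset `K` of `D` that meets every
geodesic segment for `K_D` from a point of `D` in the first neighborhood to a point of `D` in the
second one. Neighborhoods and compactness are Euclidean. -/
def HasVisibilityCondition {d : ℕ} (D : Set (EuclideanSpace ℂ (Fin d)))
    (p q : EuclideanSpace ℂ (Fin d)) : Prop :=
  ∃ Vp ∈ 𝓝 p, ∃ Vq ∈ 𝓝 q, ∃ K : Set (EuclideanSpace ℂ (Fin d)),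
    IsCompact K ∧ K ⊆ D ∧ Disjoint Vp Vq ∧
      ∀ x y : KobayashiSpace D, x.pt ∈ Vp → y.pt ∈ Vq →
        ∀ S : Set (KobayashiSpace D), IsGeodesicSegment S x y → ∃ w ∈ S, w.pt ∈ K

/-- `V` is a neighborhood that witnesses local visibility of `Ω` at `p`. -/
def IsVisibilityNeighborhood {d : ℕ} (Ω : Set (EuclideanSpace ℂ (Fin d)))
    (p : EuclideanSpace ℂ (Fin d)) (V : Set (EuclideanSpace ℂ (Fin d))) : Prop :=
  IsOpen V ∧ p ∈ V ∧ IsConnected (Ω ∩ V) ∧ IsCompleteHyperbolic (Ω ∩ V) ∧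
    ∃ V' : Set (EuclideanSpace ℂ (Fin d)), IsOpen V' ∧ p ∈ V' ∧ V' ⊆ V ∧
      ∀ q₁ ∈ frontier Ω ∩ V', ∀ q₂ ∈ frontier Ω ∩ V', q₁ ≠ q₂ →
        HasVisibilityCondition (Ω ∩ V) q₁ q₂

/-- `Ω` is locally visible at the boundary point `p`. -/
def IsLocallyVisibleAt {d : ℕ} (Ω : Set (EuclideanSpace ℂ (Fin d)))
    (p : EuclideanSpace ℂ (Fin d)) : Prop :=
  ∃ V : Set (EuclideanSpace ℂ (Fin d)), IsVisibilityNeighborhood Ω p V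

theorem half_le_artanh {x : ℝ} (h0 : 0 ≤ x) (h1 : x < 1) : x / 2 ≤ Real.artanh x := by
  have hp : 0 < (1 + x) / (1 - x) := div_pos (by linarith) (by linarith)
  rw [Real.artanh_eq_half_log ⟨by linarith, h1.le⟩]
  have h := Real.one_sub_inv_le_log_of_pos hp
  have : x ≤ 1 - ((1 + x) / (1 - x))⁻¹ := by
    rw [inv_div, le_sub_comm, div_le_iff₀ (by linarith)]
    nlinarith
  linarith

theorem artanh_sub_artanh_le {x y : ℝ} (h0 : 0 ≤ x) (hxy : x ≤ y) (hy : y ≤ 1 / 2) :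
    Real.artanh y - Real.artanh x ≤ 2 * (y - x) := by
  have hx1 : 0 < (1 + x) / (1 - x) := div_pos (by linarith) (by linarith)
  have hy1 : 0 < (1 + y) / (1 - y) := div_pos (by linarith) (by linarith)
  rw [Real.artanh_eq_half_log ⟨by linarith, by linarith⟩,
    Real.artanh_eq_half_log ⟨by linarith, by linarith⟩, ← mul_sub,
    ← Real.log_div hy1.ne' hx1.ne']
  have h := Real.log_le_sub_one_of_pos (div_pos hy1 hx1)
  have h1x : (1 - x) ≠ 0 := by linarith
  have h2x : (1 + x) ≠ 0 := by linarith
  have h1y : (1 - y) ≠ 0 := by linarith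
  have e : (1 + y) / (1 - y) / ((1 + x) / (1 - x)) - 1 = 2 * (y - x) / ((1 - y) * (1 + x)) := by
    field_simp
    ring
  have : 2 * (y - x) / ((1 - y) * (1 + x)) ≤ 4 * (y - x) := by
    rw [div_le_iff₀ (mul_pos (by linarith) (by linarith))]
    have : 1 / 2 ≤ (1 - y) * (1 + x) := by nlinarith
    nlinarith
  linarith

theorem artanh_div_le {x T : ℝ} (h0 : 0 ≤ x) (hT : 0 < T) (hT1 : T < 1) (hx : x ≤ T / 2) :
    Real.artanh (x / T) ≤ (1 + 4 * (1 / T - 1)) * Real.artanh x := by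
  have hT2 : 0 ≤ 1 / T - 1 := by
    rw [sub_nonneg, le_div_iff₀ hT]
    linarith
  have h1 : x ≤ x / T := by
    rw [le_div_iff₀ hT]
    nlinarith
  have h2 := artanh_sub_artanh_le h0 h1 (by rw [div_le_iff₀ hT]; linarith)
  have h3 := half_le_artanh h0 (by linarith)
  have h4 : x / T - x = x * (1 / T - 1) := by ring
  nlinarith

theorem Real.artanh_abs_tanh (v : ℝ) : Real.artanh |Real.tanh v| = |v| := by
  rcases le_total 0 v with h | h
  · rw [abs_of_nonneg h, abs_of_nonneg (by rw [Real.tanh_eq_sinh_div_cosh]; exact div_nonneg (Real.sinh_nonneg_iff.2 h) (Real.cosh_pos v).le), Real.artanh_tanh]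
  · rw [abs_of_nonpos h, abs_of_nonpos (by rw [Real.tanh_eq_sinh_div_cosh]; exact div_nonpos_of_nonpos_of_nonneg (Real.sinh_nonpos_iff.2 h) (Real.cosh_pos v).le), ← Real.tanh_neg, Real.artanh_tanh]

theorem tanh_sub_eq (s t : ℝ) : Real.tanh (s - t) =
    (Real.tanh s - Real.tanh t) / (1 - Real.tanh s * Real.tanh t) := by
  have hs := (Real.cosh_pos s).ne'
  have ht := (Real.cosh_pos t).ne'
  have hst := (Real.cosh_pos (s - t)).ne'
  rw [Real.tanh_eq_sinh_div_cosh, Real.tanh_eq_sinh_div_cosh, Real.tanh_eq_sinh_div_cosh]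
  have e : 1 - Real.sinh s / Real.cosh s * (Real.sinh t / Real.cosh t) =
      Real.cosh (s - t) / (Real.cosh s * Real.cosh t) := by
    rw [Real.cosh_sub]; field_simp
  rw [e, Real.sinh_sub]
  field_simp

theorem poincareDist_tanh_smul {u : ℂ} (hu : ‖u‖ = 1) (s t : ℝ) :
    poincareDist (Real.tanh s * u) (Real.tanh t * u) = |s - t| := by
  rw [poincareDist, ← Real.artanh_abs_tanh (s - t), tanh_sub_eq]
  congr 1
  have h1 : (Real.tanh s * u - Real.tanh t * u : ℂ) = ((Real.tanh s - Real.tanh t : ℝ) : ℂ) * u := by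
    push_cast; ring
  have h2 : (1 - (starRingEnd ℂ) (Real.tanh s * u) * (Real.tanh t * u) : ℂ) =
      ((1 - Real.tanh s * Real.tanh t : ℝ) : ℂ) := by
    have : (starRingEnd ℂ) u * u = 1 := by
      rw [mul_comm, Complex.mul_conj, Complex.normSq_eq_norm_sq, hu]; simp
    simp only [map_mul, Complex.conj_ofReal]
    push_cast
    linear_combination -(Complex.tanh s * Complex.tanh t) * this
  rw [h1, h2, norm_div, norm_mul, hu, mul_one, Complex.norm_real, Complex.norm_real, abs_div,
    Real.norm_eq_abs, Real.norm_eq_abs]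

theorem poincareDist_zero_left (z : ℂ) : poincareDist 0 z = Real.artanh ‖z‖ := by
  simp [poincareDist]

/-- The involutive automorphism of the unit disc that exchanges `0` and `a`. -/
noncomputable def discInvolution (a z : ℂ) : ℂ := (a - z) / (1 - (starRingEnd ℂ) a * z)

theorem one_sub_conj_mul_ne_zero {a z : ℂ} (ha : ‖a‖ < 1) (hz : ‖z‖ < 1) :
    1 - (starRingEnd ℂ) a * z ≠ 0 := by
  intro h
  have h1 : (starRingEnd ℂ) a * z = 1 := (sub_eq_zero.1 h).symm
  have h2 : ‖a‖ * ‖z‖ = 1 := by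
    rw [← Complex.norm_conj a, ← norm_mul, h1, norm_one]
  nlinarith [norm_nonneg a, norm_nonneg z]

theorem norm_discInvolution_lt_one {a z : ℂ} (ha : ‖a‖ < 1) (hz : ‖z‖ < 1) :
    ‖discInvolution a z‖ < 1 := by
  have hne := one_sub_conj_mul_ne_zero ha hz
  rw [discInvolution, norm_div, div_lt_one (norm_pos_iff.2 hne)]
  refine lt_of_pow_lt_pow_left₀ 2 (norm_nonneg _) ?_
  have ha2 : ‖a‖ ^ 2 < 1 := by nlinarith [norm_nonneg a]
  have hz2 : ‖z‖ ^ 2 < 1 := by nlinarith [norm_nonneg z]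
  simp only [← Complex.normSq_eq_norm_sq, Complex.normSq_apply] at *
  simp only [Complex.sub_re, Complex.sub_im, Complex.one_re, Complex.one_im, Complex.mul_re,
    Complex.mul_im, Complex.conj_re, Complex.conj_im]
  nlinarith [mul_pos (sub_pos.2 ha2) (sub_pos.2 hz2)]

theorem discInvolution_zero (a : ℂ) : discInvolution a 0 = a := by simp [discInvolution]

theorem discInvolution_discInvolution {a z : ℂ} (ha : ‖a‖ < 1) (hz : ‖z‖ < 1) :
    discInvolution a (discInvolution a z) = z := by
  have h1 := one_sub_conj_mul_ne_zero ha hz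
  have h2 := one_sub_conj_mul_ne_zero ha (norm_discInvolution_lt_one ha hz)
  rw [discInvolution, div_eq_iff h2]
  have e : discInvolution a z * (1 - (starRingEnd ℂ) a * z) = a - z := div_mul_cancel₀ _ h1
  linear_combination -e

theorem differentiableOn_discInvolution {a : ℂ} (ha : ‖a‖ < 1) :
    DifferentiableOn ℂ (discInvolution a) (Metric.ball 0 1) := by
  unfold discInvolution
  refine DifferentiableOn.div (by fun_prop) (by fun_prop) fun z hz => ?_
  exact one_sub_conj_mul_ne_zero ha (by simpa using hz)

variable {d : ℕ}

theorem lempertFunction_le {Ω : Set (EuclideanSpace ℂ (Fin d))} {g : ℂ → EuclideanSpace ℂ (Fin d)}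
    (hg : DifferentiableOn ℂ g (Metric.ball 0 1)) (hm : MapsTo g (Metric.ball 0 1) Ω) {a b : ℂ}
    (ha : ‖a‖ < 1) (hb : ‖b‖ < 1) :
    lempertFunction Ω (g a) (g b) ≤ ENNReal.ofReal (poincareDist a b) :=
  iInf_le_of_le g (iInf_le_of_le a (iInf_le_of_le b
    (iInf_le_of_le ⟨hg, hm, by simpa using ha, by simpa using hb, rfl, rfl⟩ le_rfl)))

theorem exists_disc_of_lempertFunction_lt {Ω : Set (EuclideanSpace ℂ (Fin d))}
    {x y : EuclideanSpace ℂ (Fin d)} {M : ℝ≥0∞} (h : lempertFunction Ω x y < M) :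
    ∃ (g : ℂ → EuclideanSpace ℂ (Fin d)) (ζ : ℂ), DifferentiableOn ℂ g (Metric.ball 0 1) ∧
      MapsTo g (Metric.ball 0 1) Ω ∧ ‖ζ‖ < 1 ∧ g 0 = x ∧ g ζ = y ∧
      ENNReal.ofReal (Real.artanh ‖ζ‖) < M := by
  unfold lempertFunction at h
  simp only [iInf_lt_iff] at h
  obtain ⟨f, a, b, ⟨hf, hm, ha, hb, rfl, rfl⟩, hM⟩ := h
  have ha' : ‖a‖ < 1 := by simpa using ha
  have hb' : ‖b‖ < 1 := by simpa using hb
  have hmaps : MapsTo (discInvolution a) (Metric.ball 0 1) (Metric.ball 0 1) := fun z hz => by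
    simpa using norm_discInvolution_lt_one ha' (by simpa using hz)
  refine ⟨f ∘ discInvolution a, discInvolution a b,
    hf.comp (differentiableOn_discInvolution ha') hmaps, hm.comp hmaps,
    norm_discInvolution_lt_one ha' hb', ?_, ?_, hM⟩
  · simp [discInvolution_zero]
  · simp [discInvolution_discInvolution ha' hb']

theorem kobayashiEDist_le_lempertFunction (Ω : Set (EuclideanSpace ℂ (Fin d)))
    (x y : EuclideanSpace ℂ (Fin d)) : kobayashiEDist Ω x y ≤ lempertFunction Ω x y := by
  refine iInf_le_of_le 1 (iInf_le_of_le (fun i => if i = 0 then x else y)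
    (iInf_le_of_le ⟨by simp, by simp⟩ ?_))
  simp

theorem exists_chain_of_kobayashiEDist_lt {Ω : Set (EuclideanSpace ℂ (Fin d))}
    {x y : EuclideanSpace ℂ (Fin d)} {M : ℝ≥0∞} (h : kobayashiEDist Ω x y < M) :
    ∃ (n : ℕ) (z : ℕ → EuclideanSpace ℂ (Fin d)), z 0 = x ∧ z n = y ∧
      ∑ i ∈ Finset.range n, lempertFunction Ω (z i) (z (i + 1)) < M := by
  unfold kobayashiEDist at h
  simp only [iInf_lt_iff] at h
  obtain ⟨n, z, ⟨h0, hn⟩, hM⟩ := h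
  exact ⟨n, z, h0, hn, hM⟩

theorem le_sum_of_le_lempertFunction {Ω : Set (EuclideanSpace ℂ (Fin d))}
    (e : EuclideanSpace ℂ (Fin d) → EuclideanSpace ℂ (Fin d) → ℝ≥0∞) (hself : ∀ x, e x x = 0)
    (htri : ∀ x y z, e x z ≤ e x y + e y z) (n : ℕ) (z : ℕ → EuclideanSpace ℂ (Fin d))
    (h : ∀ i < n, e (z i) (z (i + 1)) ≤ lempertFunction Ω (z i) (z (i + 1))) :
    e (z 0) (z n) ≤ ∑ i ∈ Finset.range n, lempertFunction Ω (z i) (z (i + 1)) := by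
  induction n with
  | zero => simp [hself]
  | succ n ih =>
    rw [Finset.sum_range_succ]
    exact (htri _ (z n) _).trans (add_le_add (ih fun i hi => h i (by omega)) (h n (by omega)))

theorem le_kobayashiEDist_of_le_lempertFunction {Ω : Set (EuclideanSpace ℂ (Fin d))}
    (e : EuclideanSpace ℂ (Fin d) → EuclideanSpace ℂ (Fin d) → ℝ≥0∞) (hself : ∀ x, e x x = 0)
    (htri : ∀ x y z, e x z ≤ e x y + e y z) (h : ∀ x y, e x y ≤ lempertFunction Ω x y)
    (x y : EuclideanSpace ℂ (Fin d)) : e x y ≤ kobayashiEDist Ω x y := by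
  refine le_iInf fun n => le_iInf fun z => le_iInf fun hz => ?_
  rw [← hz.1, ← hz.2]
  exact le_sum_of_le_lempertFunction e hself htri n z fun i _ => h _ _

theorem artanh_norm_nonneg (z : ℂ) : 0 ≤ Real.artanh ‖z‖ := Real.artanh_nonneg (norm_nonneg _)

theorem exists_mul_dist_le_kobayashiEDist {Ω : Set (EuclideanSpace ℂ (Fin d))}
    (hΩ : Bornology.IsBounded Ω) : ∃ c : ℝ, 0 < c ∧ ∀ x y,
      ENNReal.ofReal (c * dist x y) ≤ kobayashiEDist Ω x y := by
  obtain ⟨R, hR, hsub⟩ := hΩ.subset_closedBall_lt 0 0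
  refine ⟨1 / (4 * R), by positivity, ?_⟩
  refine le_kobayashiEDist_of_le_lempertFunction _ (by simp) (fun x y z => ?_) fun x y => ?_
  · rw [← ENNReal.ofReal_add (by positivity) (by positivity), ← mul_add]
    exact ENNReal.ofReal_le_ofReal (mul_le_mul_of_nonneg_left (dist_triangle _ _ _) (by positivity))
  · refine le_of_forall_gt fun M hM => ?_
    obtain ⟨g, ζ, hg, hm, hζ, rfl, rfl, hlt⟩ := exists_disc_of_lempertFunction_lt hM
    refine lt_of_le_of_lt (ENNReal.ofReal_le_ofReal ?_) hlt
    have hmaps : MapsTo g (Metric.ball 0 1) (Metric.closedBall (g 0) (2 * R)) := fun z hz => by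
      have h1 := hsub (hm hz)
      have h2 := hsub (hm (Metric.mem_ball_self one_pos))
      rw [Metric.mem_closedBall] at *
      linarith [dist_triangle_right (g z) (g 0) 0]
    have h3 := Complex.dist_le_div_mul_dist_of_mapsTo_ball hg hmaps (z := ζ) (by simpa using hζ)
    rw [dist_comm, dist_zero_right, div_one] at h3
    have h4 := half_le_artanh (norm_nonneg ζ) hζ
    rw [one_div_mul_eq_div, div_le_iff₀ (by positivity)]
    nlinarith

theorem kobayashiEDist_le_of_ball_subset {Ω : Set (EuclideanSpace ℂ (Fin d))}
    {x y : EuclideanSpace ℂ (Fin d)} {r : ℝ} (hr : 0 < r) (hball : Metric.ball x r ⊆ Ω)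
    (hy : dist x y < r) : kobayashiEDist Ω x y ≤ ENNReal.ofReal (Real.artanh (dist x y / r)) := by
  rcases eq_or_ne x y with rfl | hne
  · simp [kobayashiEDist_self]
  have hd : 0 < dist x y := dist_pos.2 hne
  let g : ℂ → EuclideanSpace ℂ (Fin d) := fun ζ => x + (ζ * ((r / dist x y : ℝ) : ℂ)) • (y - x)
  have hg : DifferentiableOn ℂ g (Metric.ball 0 1) := by
    intro z _
    apply DifferentiableAt.differentiableWithinAt
    fun_prop
  have hm : MapsTo g (Metric.ball 0 1) Ω := fun ζ hζ => hball <| by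
    rw [mem_ball_zero_iff] at hζ
    rw [Metric.mem_ball, dist_eq_norm, add_sub_cancel_left, norm_smul, norm_mul, Complex.norm_real,
      ← dist_eq_norm, dist_comm y x, Real.norm_of_nonneg (by positivity), mul_assoc,
      div_mul_cancel₀ _ hd.ne']
    nlinarith
  have h0 : g 0 = x := by simp [g]
  have hb : ‖((dist x y / r : ℝ) : ℂ)‖ = dist x y / r := by
    rw [Complex.norm_real, Real.norm_of_nonneg (by positivity)]
  have h1 : g ((dist x y / r : ℝ) : ℂ) = y := by
    have : ((dist x y / r : ℝ) : ℂ) * ((r / dist x y : ℝ) : ℂ) = 1 := by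
      rw [← Complex.ofReal_mul]
      have : dist x y / r * (r / dist x y) = 1 := by field_simp
      rw [this, Complex.ofReal_one]
    simp only [g]
    rw [this]; simp
  have h := lempertFunction_le hg hm (a := 0) (b := ((dist x y / r : ℝ) : ℂ)) (by simp)
    (by rw [hb, div_lt_one hr]; exact hy)
  rw [h0, h1, poincareDist_zero_left, hb] at h
  exact (kobayashiEDist_le_lempertFunction _ _ _).trans h

/-- A metric space in which any two points at distance less than `M` are the ends of a
`1`-Lipschitz path parametrized by `[0, M]`. -/
def HasShortPaths (X : Type*) [MetricSpace X] : Prop :=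
  ∀ (x y : X) (M : ℝ), dist x y < M → ∃ γ : ℝ → X, γ 0 = x ∧ γ M = y ∧
    ∀ s ∈ Icc 0 M, ∀ t ∈ Icc 0 M, dist (γ s) (γ t) ≤ |s - t|

section HopfRinow

variable {X : Type*} [MetricSpace X]

theorem HasShortPaths.exists_between (h : HasShortPaths X) {x y : X} {M s : ℝ}
    (hM : dist x y < M) (h0 : 0 ≤ s) (hs : s ≤ M) : ∃ z, dist x z ≤ s ∧ dist z y ≤ M - s := by
  obtain ⟨γ, rfl, rfl, hγ⟩ := h x y M hM
  have hM0 : 0 ≤ M := h0.trans hs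
  refine ⟨γ s, ?_, ?_⟩
  · simpa [abs_of_nonneg h0] using hγ 0 ⟨le_rfl, hM0⟩ s ⟨h0, hs⟩
  · simpa [abs_sub_comm s M, abs_of_nonneg (sub_nonneg.2 hs)] using
      hγ s ⟨h0, hs⟩ M ⟨hM0, le_rfl⟩

theorem HasShortPaths.isCompact_closedBall_of_forall_lt [CompleteSpace X] (h : HasShortPaths X)
    {x : X} {r : ℝ} (hr : 0 < r) (hc : ∀ r' < r, IsCompact (Metric.closedBall x r')) :
    IsCompact (Metric.closedBall x r) := by
  refine TotallyBounded.isCompact_of_isClosed ?_ Metric.isClosed_closedBall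
  refine Metric.totallyBounded_iff.2 fun ε₀ hε₀ => ?_
  obtain ⟨ε, hε, hεr, hεε⟩ : ∃ ε, 0 < ε ∧ ε ≤ r ∧ ε ≤ ε₀ :=
    ⟨min ε₀ r, lt_min hε₀ hr, min_le_right _ _, min_le_left _ _⟩
  obtain ⟨t, ht, hcov⟩ := Metric.totallyBounded_iff.1
    (hc (r - ε / 3) (by linarith)).totallyBounded (ε / 2) (by linarith)
  refine ⟨t, ht, fun y hy => ?_⟩
  rw [Metric.mem_closedBall, dist_comm] at hy
  obtain ⟨z, hz1, hz2⟩ := h.exists_between (x := x) (y := y) (M := r + ε / 6) (s := r - ε / 3)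
    (by linarith) (by linarith) (by linarith)
  have hz := hcov (Metric.mem_closedBall'.2 hz1)
  simp only [mem_iUnion, Metric.mem_ball, exists_prop] at hz ⊢
  obtain ⟨c, hct, hzc⟩ := hz
  exact ⟨c, hct, by linarith [dist_triangle_left y c z]⟩

theorem HasShortPaths.exists_gt_isCompact_closedBall [LocallyCompactSpace X] (h : HasShortPaths X)
    {x : X} {r : ℝ} (hr : 0 ≤ r) (hc : IsCompact (Metric.closedBall x r)) :
    ∃ r' > r, IsCompact (Metric.closedBall x r') := by
  obtain ⟨K, hK, hsub⟩ := exists_compact_superset hc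
  obtain ⟨δ, hδ, hthick⟩ := hc.exists_thickening_subset_open isOpen_interior hsub
  refine ⟨r + δ / 2, by linarith, hK.of_isClosed_subset Metric.isClosed_closedBall fun y hy => ?_⟩
  rw [Metric.mem_closedBall, dist_comm] at hy
  obtain ⟨z, hz1, hz2⟩ := h.exists_between (x := x) (y := y) (M := r + 3 * δ / 4) (s := r)
    (by linarith) hr (by linarith)
  refine interior_subset (hthick (Metric.mem_thickening_iff.2 ⟨z, Metric.mem_closedBall'.2 hz1, ?_⟩))
  rw [dist_comm]
  linarith

/-- The Hopf–Rinow–Cohn-Vossen theorem. -/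
theorem HasShortPaths.properSpace [CompleteSpace X] [LocallyCompactSpace X]
    (h : HasShortPaths X) : ProperSpace X := by
  refine ⟨fun x r₀ => ?_⟩
  by_contra hcon
  have hr₀ : 0 < r₀ := by
    by_contra hle
    refine hcon ((Metric.subsingleton_closedBall x (not_lt.1 hle)).isCompact)
  let S : Set ℝ := {r | 0 ≤ r ∧ IsCompact (Metric.closedBall x r)}
  have hmono : ∀ r ∈ S, ∀ r' ≤ r, IsCompact (Metric.closedBall x r') := fun r hr r' hle =>
    hr.2.of_isClosed_subset Metric.isClosed_closedBall (Metric.closedBall_subset_closedBall hle)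
  have hS0 : (0 : ℝ) ∈ S := ⟨le_rfl, by simp⟩
  have hbdd : BddAbove S := ⟨r₀, fun r hr => by
    by_contra hlt
    exact hcon (hmono r hr r₀ (not_le.1 hlt).le)⟩
  obtain ⟨r₁, hr₁, hc₁⟩ := h.exists_gt_isCompact_closedBall le_rfl hS0.2
  have hpos : 0 < sSup S := lt_of_lt_of_le hr₁ (le_csSup hbdd ⟨hr₁.le, hc₁⟩)
  have hR : IsCompact (Metric.closedBall x (sSup S)) :=
    h.isCompact_closedBall_of_forall_lt hpos fun r' hr' => by
      obtain ⟨r, hr, hlt⟩ := exists_lt_of_lt_csSup ⟨0, hS0⟩ hr'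
      exact hmono r hr r' hlt.le
  obtain ⟨r₂, hr₂, hc₂⟩ := h.exists_gt_isCompact_closedBall hpos.le hR
  exact absurd (le_csSup hbdd ⟨hpos.le.trans hr₂.le, hc₂⟩) (not_le.2 hr₂)

theorem HasShortPaths.exists_geodesic [ProperSpace X] (h : HasShortPaths X) (x y : X) :
    ∃ γ : ℝ → X, γ 0 = x ∧ γ (dist x y) = y ∧
      ∀ s ∈ Icc 0 (dist x y), ∀ t ∈ Icc 0 (dist x y), dist (γ s) (γ t) = |s - t| := by
  set L := dist x y with hL
  have hL0 : 0 ≤ L := dist_nonneg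
  have hlt : ∀ n : ℕ, dist x y < L + 1 / ((n : ℝ) + 1) := fun n => by
    have : 0 < 1 / ((n : ℝ) + 1) := by positivity
    linarith
  choose γ hγ0 hγ1 hγ using fun n : ℕ => h x y (L + 1 / ((n : ℝ) + 1)) (hlt n)
  have hsub : ∀ (n : ℕ) t, t ∈ Icc 0 L → t ∈ Icc 0 (L + 1 / ((n : ℝ) + 1)) := fun n t ht =>
    ⟨ht.1, by have := hlt n; linarith [ht.2]⟩
  let 𝒰 : Ultrafilter ℕ := Filter.hyperfilter ℕ
  have hlim : ∀ t : ℝ, ∃ z, t ∈ Icc 0 L → Filter.Tendsto (fun n => γ n t) 𝒰 (𝓝 z) := by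
    intro t
    by_cases ht : t ∈ Icc 0 L
    · obtain ⟨z, -, hz⟩ := (isCompact_closedBall x L).ultrafilter_le_nhds
        (𝒰.map fun n => γ n t) (by
          rw [Ultrafilter.coe_map, Filter.le_principal_iff, Filter.mem_map]
          refine Filter.Eventually.of_forall fun n => ?_
          have := hγ n 0 (hsub n 0 ⟨le_rfl, hL0⟩) t (hsub n t ht)
          rw [hγ0, zero_sub, abs_neg, abs_of_nonneg ht.1] at this
          exact Metric.mem_closedBall'.2 (this.trans ht.2))
      exact ⟨z, fun _ => hz⟩
    · exact ⟨x, fun h => absurd h ht⟩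
  choose g hg using hlim
  have hle : ∀ s ∈ Icc 0 L, ∀ t ∈ Icc 0 L, dist (g s) (g t) ≤ |s - t| := fun s hs t ht =>
    le_of_tendsto ((hg s hs).dist (hg t ht))
      (Filter.Eventually.of_forall fun n => hγ n s (hsub n s hs) t (hsub n t ht))
  have hg0 : g 0 = x := by
    refine tendsto_nhds_unique (hg 0 ⟨le_rfl, hL0⟩) ?_
    simp only [hγ0]
    exact tendsto_const_nhds
  have hgL : g L = y := by
    refine tendsto_nhds_unique (hg L ⟨hL0, le_rfl⟩) (tendsto_iff_dist_tendsto_zero.2 ?_)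
    refine squeeze_zero (g := fun n : ℕ => 1 / ((n : ℝ) + 1)) (fun _ => dist_nonneg) (fun n => ?_)
      (tendsto_one_div_add_atTop_nhds_zero_nat.mono_left Nat.hyperfilter_le_atTop)
    have h1 : 0 < 1 / ((n : ℝ) + 1) := by positivity
    have := hγ n L (hsub n L ⟨hL0, le_rfl⟩) _ ⟨by linarith, le_rfl⟩
    rwa [hγ1, sub_add_cancel_left, abs_neg, abs_of_pos h1] at this
  refine ⟨g, hg0, hgL, ?_⟩
  have key : ∀ s ∈ Icc 0 L, ∀ t ∈ Icc 0 L, s ≤ t → dist (g s) (g t) = |s - t| := by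
    intro s hs t ht hst
    refine le_antisymm (hle s hs t ht) ?_
    have h1 := hle 0 ⟨le_rfl, hL0⟩ s hs
    have h2 := hle t ht L ⟨hL0, le_rfl⟩
    rw [hg0, zero_sub, abs_neg, abs_of_nonneg hs.1] at h1
    rw [hgL, abs_sub_comm, abs_of_nonneg (by linarith [ht.2])] at h2
    rw [abs_sub_comm, abs_of_nonneg (by linarith)]
    linarith [dist_triangle4 x (g s) (g t) y]
  intro s hs t ht
  rcases le_total s t with hst | hst
  · exact key s hs t ht hst
  · rw [dist_comm, abs_sub_comm]
    exact key t ht s hs hst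

end HopfRinow

section ShortPaths

variable {D : Set (EuclideanSpace ℂ (Fin d))}

/-- `x` and `y` are the ends of a path in `D` that is parametrized by `[0, M]` and is
`1`-Lipschitz for the Kobayashi pseudodistance. -/
def JoinedByShortPath (D : Set (EuclideanSpace ℂ (Fin d))) (x y : EuclideanSpace ℂ (Fin d))
    (M : ℝ) : Prop :=
  ∃ γ : ℝ → EuclideanSpace ℂ (Fin d), γ 0 = x ∧ γ M = y ∧ (∀ t ∈ Icc 0 M, γ t ∈ D) ∧
    ∀ s ∈ Icc 0 M, ∀ t ∈ Icc 0 M, kobayashiEDist D (γ s) (γ t) ≤ ENNReal.ofReal |s - t|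

theorem JoinedByShortPath.refl {x : EuclideanSpace ℂ (Fin d)} (hx : x ∈ D) (M : ℝ) :
    JoinedByShortPath D x x M :=
  ⟨fun _ => x, rfl, rfl, fun _ _ => hx, fun _ _ _ _ => by simp [kobayashiEDist_self]⟩

theorem JoinedByShortPath.trans {x y z : EuclideanSpace ℂ (Fin d)} {M N : ℝ} (hM : 0 ≤ M)
    (hN : 0 ≤ N) (h₁ : JoinedByShortPath D x y M) (h₂ : JoinedByShortPath D y z N) :
    JoinedByShortPath D x z (M + N) := by
  obtain ⟨γ, hγ0, hγM, hγD, hγ⟩ := h₁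
  obtain ⟨σ, hσ0, hσN, hσD, hσ⟩ := h₂
  have key : ∀ s ∈ Icc 0 (M + N), ∀ t ∈ Icc 0 (M + N), s ≤ t →
      kobayashiEDist D (if s ≤ M then γ s else σ (s - M)) (if t ≤ M then γ t else σ (t - M)) ≤
        ENNReal.ofReal |s - t| := by
    intro s hs t ht hst
    rcases le_or_gt t M with htM | htM
    · rw [if_pos htM, if_pos (hst.trans htM)]
      exact hγ s ⟨hs.1, hst.trans htM⟩ t ⟨ht.1, htM⟩
    have ht' : t - M ∈ Icc 0 N := ⟨by linarith, by linarith [ht.2]⟩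
    rw [if_neg (not_le.2 htM)]
    rcases le_or_gt s M with hsM | hsM
    · rw [if_pos hsM]
      refine (kobayashiEDist_triangle D _ y _).trans ?_
      have h1 := hγ s ⟨hs.1, hsM⟩ M ⟨hM, le_rfl⟩
      have h2 := hσ 0 ⟨le_rfl, hN⟩ _ ht'
      rw [hγM] at h1
      rw [hσ0] at h2
      refine (add_le_add h1 h2).trans ?_
      rw [← ENNReal.ofReal_add (abs_nonneg _) (abs_nonneg _)]
      refine ENNReal.ofReal_le_ofReal ?_
      rw [abs_of_nonpos (by linarith), abs_of_nonpos (by linarith), abs_of_nonpos (by linarith)]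
      linarith
    · rw [if_neg (not_le.2 hsM)]
      refine (hσ _ ⟨by linarith, by linarith [hs.2]⟩ _ ht').trans_eq ?_
      rw [sub_sub_sub_cancel_right]
  refine ⟨fun t => if t ≤ M then γ t else σ (t - M), by simp [hM, hγ0], ?_, ?_, ?_⟩
  · rcases hN.eq_or_lt with rfl | hN
    · simp [hγM, ← hσN, hσ0]
    · simp [hN, hσN]
  · intro t ht
    dsimp only
    split_ifs with h
    · exact hγD t ⟨ht.1, h⟩
    · exact hσD _ ⟨by linarith, by linarith [ht.2]⟩
  · intro s hs t ht
    rcases le_total s t with hst | hst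
    · exact key s hs t ht hst
    · rw [kobayashiEDist_comm, abs_sub_comm]
      exact key t ht s hs hst

theorem joinedByShortPath_of_lempertFunction_lt {x y : EuclideanSpace ℂ (Fin d)} {M : ℝ}
    (h : lempertFunction D x y < ENNReal.ofReal M) : JoinedByShortPath D x y M := by
  obtain ⟨g, ζ, hg, hm, hζ, rfl, rfl, hlt⟩ := exists_disc_of_lempertFunction_lt h
  set ρ := Real.artanh ‖ζ‖ with hρ
  have hρ0 : 0 ≤ ρ := artanh_norm_nonneg ζ
  have hρM : ρ < M := by
    by_contra hle
    exact absurd hlt (not_lt.2 (ENNReal.ofReal_le_ofReal (not_lt.1 hle)))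
  obtain ⟨u, hu, huζ⟩ : ∃ u : ℂ, ‖u‖ = 1 ∧ ((‖ζ‖ : ℝ) : ℂ) * u = ζ := by
    rcases eq_or_ne ζ 0 with rfl | hne
    · exact ⟨1, by simp, by simp⟩
    · have : ((‖ζ‖ : ℝ) : ℂ) ≠ 0 := by simpa using hne
      exact ⟨ζ / (‖ζ‖ : ℝ), by simp [hne], by field_simp⟩
  have hnorm : ∀ v : ℝ, ‖((Real.tanh v : ℝ) : ℂ) * u‖ < 1 := fun v => by
    rw [norm_mul, hu, mul_one, Complex.norm_real, Real.norm_eq_abs, abs_lt]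
    exact ⟨Real.neg_one_lt_tanh v, Real.tanh_lt_one v⟩
  refine ⟨fun t => g (((Real.tanh (min t ρ) : ℝ) : ℂ) * u), by simp [hρ0], ?_, ?_, ?_⟩
  · have : Real.tanh ρ = ‖ζ‖ := Real.tanh_artanh ⟨by linarith [norm_nonneg ζ], hζ⟩
    simp only [min_eq_right hρM.le]
    rw [this, huζ]
  · exact fun t _ => hm (by simpa using hnorm _)
  · intro s _ t _
    refine (kobayashiEDist_le_lempertFunction _ _ _).trans
      ((lempertFunction_le hg hm (hnorm _) (hnorm _)).trans ?_)
    rw [poincareDist_tanh_smul hu]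
    refine ENNReal.ofReal_le_ofReal ?_
    simpa using abs_min_sub_min_le_max s ρ t ρ

theorem joinedByShortPath_of_sum_lt (n : ℕ) (z : ℕ → EuclideanSpace ℂ (Fin d)) (hz : z 0 ∈ D)
    {M : ℝ} (h : ∑ i ∈ Finset.range n, lempertFunction D (z i) (z (i + 1)) < ENNReal.ofReal M) :
    JoinedByShortPath D (z 0) (z n) M := by
  induction n generalizing M with
  | zero => exact JoinedByShortPath.refl hz M
  | succ n ih =>
    rw [Finset.sum_range_succ] at h
    set A := ∑ i ∈ Finset.range n, lempertFunction D (z i) (z (i + 1)) with hA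
    set B := lempertFunction D (z n) (z (n + 1)) with hB
    have hA' : A ≠ ⊤ := fun h' => by simp [h'] at h
    have hB' : B ≠ ⊤ := fun h' => by simp [h'] at h
    have hAB : A.toReal + B.toReal < M := by
      rw [← ENNReal.ofReal_toReal hA', ← ENNReal.ofReal_toReal hB',
        ← ENNReal.ofReal_add ENNReal.toReal_nonneg ENNReal.toReal_nonneg] at h
      exact (ENNReal.ofReal_lt_ofReal_iff_of_nonneg (by positivity)).1 h
    set ε := (M - A.toReal - B.toReal) / 2 with hε
    have hε0 : 0 < ε := by rw [hε]; linarith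
    have e : M = (A.toReal + ε) + (B.toReal + ε) := by rw [hε]; ring
    rw [e]
    refine JoinedByShortPath.trans (by positivity) (by positivity) (ih ?_)
      (joinedByShortPath_of_lempertFunction_lt ?_)
    · rw [ENNReal.lt_ofReal_iff_toReal_lt hA']
      linarith
    · rw [ENNReal.lt_ofReal_iff_toReal_lt hB']
      linarith

theorem joinedByShortPath_of_kobayashiEDist_lt {x y : EuclideanSpace ℂ (Fin d)} (hx : x ∈ D)
    {M : ℝ} (h : kobayashiEDist D x y < ENNReal.ofReal M) : JoinedByShortPath D x y M := by
  obtain ⟨n, z, rfl, rfl, hz⟩ := exists_chain_of_kobayashiEDist_lt h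
  exact joinedByShortPath_of_sum_lt n z hx hz

end ShortPaths

theorem ENNReal.le_mul_of_forall_lt_imp_le_mul {a b C N : ℝ≥0∞} (hC0 : C ≠ 0) (hC : C ≠ ⊤)
    (haN : a < N) (h : ∀ M, a < M → M ≤ N → b ≤ C * M) : b ≤ C * a := by
  by_contra hcon
  have h1 : a < b / C := by
    rw [ENNReal.lt_div_iff_mul_lt (Or.inl hC0) (Or.inl hC), mul_comm]
    exact not_le.1 hcon
  obtain ⟨M, hM1, hM2⟩ := exists_between (lt_min h1 haN)
  have h2 := hM2.trans_le (min_le_left _ _)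
  rw [ENNReal.lt_div_iff_mul_lt (Or.inl hC0) (Or.inl hC), mul_comm] at h2
  exact absurd (h M hM1 (hM2.le.trans (min_le_right _ _))) (not_le.2 h2)

section Localization

variable {G H B : Set (EuclideanSpace ℂ (Fin d))}

theorem lempertFunction_le_mul_of_far (hGB : G ∩ B ⊆ H) {z z' : EuclideanSpace ℂ (Fin d)} {T : ℝ}
    (hT : 0 < T) (hT1 : T < 1)
    (hfar : ∀ w ∈ G \ B, ENNReal.ofReal (Real.artanh T) ≤ kobayashiEDist G z w)
    (h : lempertFunction G z z' < ENNReal.ofReal (T / 4)) :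
    lempertFunction H z z' ≤ ENNReal.ofReal (1 + 4 * (1 / T - 1)) * lempertFunction G z z' := by
  have hT2 : 0 ≤ 1 / T - 1 := by
    rw [sub_nonneg, le_div_iff₀ hT]
    linarith
  refine ENNReal.le_mul_of_forall_lt_imp_le_mul
    (ENNReal.ofReal_pos.2 (by positivity)).ne' ENNReal.ofReal_ne_top h fun M hM hMT => ?_
  obtain ⟨g, ζ, hg, hm, hζ, rfl, rfl, hlt⟩ := exists_disc_of_lempertFunction_lt hM
  have h1 : Real.artanh ‖ζ‖ < T / 4 :=
    (ENNReal.ofReal_lt_ofReal_iff_of_nonneg (artanh_norm_nonneg ζ)).1 (hlt.trans_le hMT)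
  have h2 := half_le_artanh (norm_nonneg ζ) hζ
  have hscale : MapsTo (fun ξ : ℂ => (T : ℂ) * ξ) (Metric.ball 0 1) (Metric.ball 0 1) :=
    fun ξ hξ => by
      rw [mem_ball_zero_iff] at *
      rw [norm_mul, Complex.norm_real, Real.norm_of_nonneg hT.le]
      nlinarith [norm_nonneg ξ]
  have hmaps : MapsTo (fun ξ : ℂ => g ((T : ℂ) * ξ)) (Metric.ball 0 1) H := by
    intro ξ hξ
    have hTξ := hscale hξ
    rw [mem_ball_zero_iff] at hξ hTξ
    have hG : g (T * ξ) ∈ G := hm (by simpa using hTξ)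
    refine hGB ⟨hG, ?_⟩
    by_contra hB
    have h3 := (hfar _ ⟨hG, hB⟩).trans ((kobayashiEDist_le_lempertFunction _ _ _).trans
      (lempertFunction_le hg hm (by simp) hTξ))
    rw [poincareDist_zero_left, ENNReal.ofReal_le_ofReal_iff (artanh_norm_nonneg _),
      Real.artanh_le_artanh_iff ⟨by linarith, hT1⟩ ⟨by linarith [norm_nonneg ((T : ℂ) * ξ)], hTξ⟩,
      norm_mul, Complex.norm_real, Real.norm_of_nonneg hT.le] at h3
    nlinarith
  have hn : ‖ζ / (T : ℂ)‖ = ‖ζ‖ / T := by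
    rw [norm_div, Complex.norm_real, Real.norm_of_nonneg hT.le]
  have hTC : (T : ℂ) ≠ 0 := by exact_mod_cast hT.ne'
  have h4 := lempertFunction_le (hg.comp (by fun_prop) hscale) hmaps (a := 0) (b := ζ / T)
    (by simp) (by rw [hn, div_lt_one hT]; linarith)
  simp only [Function.comp_apply, mul_zero, mul_div_cancel₀ _ hTC] at h4
  rw [poincareDist_zero_left, hn] at h4
  refine h4.trans ?_
  calc ENNReal.ofReal (Real.artanh (‖ζ‖ / T))
      ≤ ENNReal.ofReal ((1 + 4 * (1 / T - 1)) * Real.artanh ‖ζ‖) :=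
        ENNReal.ofReal_le_ofReal (artanh_div_le (norm_nonneg ζ) hT hT1 (by linarith))
    _ = ENNReal.ofReal (1 + 4 * (1 / T - 1)) * ENNReal.ofReal (Real.artanh ‖ζ‖) :=
        ENNReal.ofReal_mul (by positivity)
    _ ≤ _ := mul_le_mul_right hlt.le _

/-- Royden's localization lemma for the Kobayashi distance, at small scales. -/
theorem kobayashiEDist_le_mul_of_far (hGB : G ∩ B ⊆ H) {z z' : EuclideanSpace ℂ (Fin d)} {r : ℝ}
    (hr : 0 < r) (hfar : ∀ w ∈ G \ B, ENNReal.ofReal r ≤ kobayashiEDist G z w)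
    (h : kobayashiEDist G z z' < ENNReal.ofReal (Real.tanh (r / 2) / 4)) :
    kobayashiEDist H z z' ≤
      ENNReal.ofReal (1 + 4 * (1 / Real.tanh (r / 2) - 1)) * kobayashiEDist G z z' := by
  set T := Real.tanh (r / 2) with hTdef
  have hT : 0 < T := by
    rw [hTdef, Real.tanh_eq_sinh_div_cosh]
    exact div_pos (Real.sinh_pos_iff.2 (by linarith)) (Real.cosh_pos _)
  have hT1 : T < 1 := Real.tanh_lt_one _
  have hTr : Real.artanh T = r / 2 := Real.artanh_tanh _
  have hT4 : T / 4 ≤ r / 2 := by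
    have := half_le_artanh hT.le hT1
    linarith
  have hT2 : 0 ≤ 1 / T - 1 := by
    rw [sub_nonneg, le_div_iff₀ hT]
    linarith
  refine ENNReal.le_mul_of_forall_lt_imp_le_mul
    (ENNReal.ofReal_pos.2 (by positivity)).ne' ENNReal.ofReal_ne_top h fun M hM hMT => ?_
  obtain ⟨n, u, rfl, rfl, hu⟩ := exists_chain_of_kobayashiEDist_lt hM
  have hpart : ∀ i ≤ n, kobayashiEDist G (u 0) (u i) ≤ ENNReal.ofReal (r / 2) := fun i hi => by
    refine (le_sum_of_le_lempertFunction (kobayashiEDist G) (kobayashiEDist_self G)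
      (kobayashiEDist_triangle G) i u
      fun _ _ => kobayashiEDist_le_lempertFunction _ _ _).trans ?_
    refine (Finset.sum_le_sum_of_subset (Finset.range_mono hi)).trans
      (hu.le.trans (hMT.trans (ENNReal.ofReal_le_ofReal hT4)))
  have hlink : ∀ i < n, kobayashiEDist H (u i) (u (i + 1)) ≤
      ENNReal.ofReal (1 + 4 * (1 / T - 1)) * lempertFunction G (u i) (u (i + 1)) := by
    intro i hi
    refine (kobayashiEDist_le_lempertFunction _ _ _).trans
      (lempertFunction_le_mul_of_far hGB hT hT1 (fun w hw => ?_) ?_)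
    · rw [hTr]
      have h1 := (hfar w hw).trans (kobayashiEDist_triangle G (u 0) (u i) w)
      have h2 : ENNReal.ofReal r = ENNReal.ofReal (r / 2) + ENNReal.ofReal (r / 2) := by
        rw [← ENNReal.ofReal_add (by positivity) (by positivity), add_halves]
      rw [h2] at h1
      exact (ENNReal.add_le_add_iff_left ENNReal.ofReal_ne_top).1
        (h1.trans (add_le_add_left (hpart i hi.le) _))
    · refine lt_of_le_of_lt ?_ (hu.trans_le hMT)
      exact Finset.single_le_sum (f := fun i => lempertFunction G (u i) (u (i + 1)))
        (fun _ _ => zero_le) (Finset.mem_range.2 hi)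
  have hsum : kobayashiEDist H (u 0) (u n) ≤
      ∑ i ∈ Finset.range n, kobayashiEDist H (u i) (u (i + 1)) := by
    clear hpart hlink hu hM h hfar
    induction n with
    | zero => simp [kobayashiEDist_self]
    | succ n ih =>
      rw [Finset.sum_range_succ]
      exact (kobayashiEDist_triangle H _ (u n) _).trans (add_le_add_left ih _)
  refine hsum.trans ((Finset.sum_le_sum fun i hi => hlink i (Finset.mem_range.1 hi)).trans ?_)
  rw [← Finset.mul_sum]
  exact mul_le_mul_right hu.le _

theorem four_mul_one_div_tanh_sub_one_le {r₀ r : ℝ} (hr₀ : 0 < r₀) (hr : r₀ ≤ r) :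
    4 * (1 / Real.tanh (r / 2) - 1) ≤ 8 / (1 - Real.exp (-r₀)) * Real.exp (-r) := by
  have h1 : Real.exp (-r) < 1 := Real.exp_lt_one_iff.2 (by linarith)
  have h0 : Real.exp (-r₀) < 1 := Real.exp_lt_one_iff.2 (by linarith)
  have h2 : Real.exp (-r) ≤ Real.exp (-r₀) := Real.exp_le_exp.2 (by linarith)
  have hp := Real.exp_pos (-r)
  have e1 : Real.tanh (r / 2) = (1 - Real.exp (-r)) / (1 + Real.exp (-r)) := by
    have hq := Real.exp_pos (r / 2)
    have hq' := Real.exp_pos (-(r / 2))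
    have e2 : Real.exp (-r) = Real.exp (-(r / 2)) / Real.exp (r / 2) := by
      rw [← Real.exp_sub]; congr 1; ring
    rw [Real.tanh_eq, e2]
    field_simp
  rw [e1]
  have e3 : 4 * (1 / ((1 - Real.exp (-r)) / (1 + Real.exp (-r))) - 1) =
      8 / (1 - Real.exp (-r)) * Real.exp (-r) := by
    have : 1 - Real.exp (-r) ≠ 0 := by linarith
    field_simp
    ring
  rw [e3]
  gcongr

theorem Real.tanh_le_tanh_of_le {x y : ℝ} (h : x ≤ y) : Real.tanh x ≤ Real.tanh y := by
  rw [← Real.artanh_le_artanh_iff ⟨Real.neg_one_lt_tanh x, Real.tanh_lt_one x⟩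
    ⟨Real.neg_one_lt_tanh y, Real.tanh_lt_one y⟩, Real.artanh_tanh, Real.artanh_tanh]
  exact h

/-- A geodesic of `D` for the Kobayashi distance, parametrized by `[0, L]`. -/
structure IsKobayashiGeodesic (D : Set (EuclideanSpace ℂ (Fin d)))
    (γ : ℝ → EuclideanSpace ℂ (Fin d)) (L : ℝ) : Prop where
  nonneg : 0 ≤ L
  mem : ∀ t ∈ Icc 0 L, γ t ∈ D
  edist_eq : ∀ s ∈ Icc 0 L, ∀ t ∈ Icc 0 L, kobayashiEDist D (γ s) (γ t) = ENNReal.ofReal |s - t|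

theorem kobayashiEDist_le_of_local {γ : ℝ → EuclideanSpace ℂ (Fin d)} {F : ℝ → ℝ} {L h : ℝ}
    (hh : 0 < h) (hL : 0 ≤ L) (hF : MonotoneOn F (Icc 0 L))
    (hloc : ∀ s ∈ Icc 0 L, ∀ t ∈ Icc 0 L, s ≤ t → t ≤ s + h →
      kobayashiEDist H (γ s) (γ t) ≤ ENNReal.ofReal (F t - F s)) :
    kobayashiEDist H (γ 0) (γ L) ≤ ENNReal.ofReal (F L - F 0) := by
  have key : ∀ (n : ℕ) (t : ℝ), t ∈ Icc 0 L → t ≤ n * h →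
      kobayashiEDist H (γ 0) (γ t) ≤ ENNReal.ofReal (F t - F 0) := by
    intro n
    induction n with
    | zero =>
      intro t ht hn
      have : t = 0 := le_antisymm (by simpa using hn) ht.1
      simp [this, kobayashiEDist_self]
    | succ n ih =>
      intro t ht hn
      push_cast at hn
      have hs : max 0 (t - h) ∈ Icc 0 L :=
        ⟨le_max_left _ _, max_le hL (by linarith [ht.2])⟩
      have hst : max 0 (t - h) ≤ t := max_le ht.1 (by linarith)
      have h1 := ih (max 0 (t - h)) hs (max_le (by positivity) (by linarith))
      have h2 := hloc _ hs t ht hst (by linarith [le_max_right 0 (t - h)])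
      refine (kobayashiEDist_triangle H _ _ _).trans ((add_le_add h1 h2).trans_eq ?_)
      rw [← ENNReal.ofReal_add (sub_nonneg.2 (hF ⟨le_rfl, hL⟩ hs hs.1))
        (sub_nonneg.2 (hF hs ht hst))]
      congr 1
      ring
  obtain ⟨n, hn⟩ := exists_nat_ge (L / h)
  exact key n L ⟨hL, le_rfl⟩ ((div_le_iff₀ hh).1 hn)

theorem IsKobayashiGeodesic.edist_le_of_far (hGB : G ∩ B ⊆ H) {r₀ r : ℝ} (hr₀ : 0 < r₀)
    (hr : r₀ ≤ r) {γ : ℝ → EuclideanSpace ℂ (Fin d)} {L : ℝ} (hγ : IsKobayashiGeodesic G γ L)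
    {s t : ℝ} (hs : s ∈ Icc 0 L) (ht : t ∈ Icc 0 L) (hst : s ≤ t)
    (hts : t ≤ s + Real.tanh (r₀ / 2) / 8)
    (hfar : ∀ w ∈ G \ B, ENNReal.ofReal r ≤ kobayashiEDist G (γ s) w) :
    kobayashiEDist H (γ s) (γ t) ≤
      ENNReal.ofReal ((1 + 8 / (1 - Real.exp (-r₀)) * Real.exp (-r)) * (t - s)) := by
  have hT : 0 < Real.tanh (r₀ / 2) := by
    rw [Real.tanh_eq_sinh_div_cosh]
    exact div_pos (Real.sinh_pos_iff.2 (by linarith)) (Real.cosh_pos _)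
  have hTr : Real.tanh (r₀ / 2) ≤ Real.tanh (r / 2) := Real.tanh_le_tanh_of_le (by linarith)
  have he : kobayashiEDist G (γ s) (γ t) = ENNReal.ofReal (t - s) := by
    rw [hγ.edist_eq s hs t ht, abs_sub_comm, abs_of_nonneg (sub_nonneg.2 hst)]
  have h1 := kobayashiEDist_le_mul_of_far hGB (hr₀.trans_le hr) hfar (z' := γ t) (by
    rw [he]
    exact (ENNReal.ofReal_lt_ofReal_iff (by linarith)).2 (by linarith))
  refine h1.trans ?_
  rw [he]
  have h0 : Real.exp (-r₀) < 1 := Real.exp_lt_one_iff.2 (by linarith)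
  have h1 : 0 < 1 - Real.exp (-r₀) := by linarith
  rw [ENNReal.ofReal_mul (by positivity)]
  refine mul_le_mul_left (ENNReal.ofReal_le_ofReal ?_) _
  linarith [four_mul_one_div_tanh_sub_one_le hr₀ hr]

theorem exists_kobayashiEDist_le_mul_length (hGB : G ∩ B ⊆ H) {r₀ : ℝ} (hr₀ : 0 < r₀) :
    ∃ C : ℝ, 0 < C ∧ ∀ γ L, IsKobayashiGeodesic G γ L →
      (∀ t ∈ Icc 0 L, ∀ w ∈ G \ B, ENNReal.ofReal r₀ ≤ kobayashiEDist G (γ t) w) →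
      kobayashiEDist H (γ 0) (γ L) ≤ ENNReal.ofReal (C * L) := by
  have hT : 0 < Real.tanh (r₀ / 2) := by
    rw [Real.tanh_eq_sinh_div_cosh]
    exact div_pos (Real.sinh_pos_iff.2 (by linarith)) (Real.cosh_pos _)
  have h0 : Real.exp (-r₀) < 1 := Real.exp_lt_one_iff.2 (by linarith)
  have h1 : 0 < 1 - Real.exp (-r₀) := by linarith
  set C := 1 + 8 / (1 - Real.exp (-r₀)) * Real.exp (-r₀) with hC
  have hC0 : 0 < C := by positivity
  refine ⟨C, hC0, fun γ L hγ hfar => ?_⟩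
  have := kobayashiEDist_le_of_local (H := H) (γ := γ) (F := fun t => C * t) (L := L)
    (h := Real.tanh (r₀ / 2) / 8) (by positivity) hγ.nonneg
    (fun s _ t _ hst => mul_le_mul_of_nonneg_left hst hC0.le) fun s hs t ht hst hts => by
      rw [← mul_sub]
      exact hγ.edist_le_of_far hGB hr₀ le_rfl hs ht hst hts (hfar s hs)
  simpa using this

theorem exists_kobayashiEDist_le_length_add (hGB : G ∩ B ⊆ H) {r₀ α : ℝ} (hr₀ : 0 < r₀)
    (hα : 0 < α) (β : ℝ) :
    ∃ C : ℝ, 0 ≤ C ∧ ∀ γ L, IsKobayashiGeodesic G γ L →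
      (∀ t ∈ Icc 0 L, ∀ w ∈ G \ B,
        ENNReal.ofReal (max r₀ (α * t - β)) ≤ kobayashiEDist G (γ t) w) →
      kobayashiEDist H (γ 0) (γ L) ≤ ENNReal.ofReal (L + C) := by
  have hT : 0 < Real.tanh (r₀ / 2) := by
    rw [Real.tanh_eq_sinh_div_cosh]
    exact div_pos (Real.sinh_pos_iff.2 (by linarith)) (Real.cosh_pos _)
  have h0 : Real.exp (-r₀) < 1 := Real.exp_lt_one_iff.2 (by linarith)
  have h1 : 0 < 1 - Real.exp (-r₀) := by linarith
  set A := 8 / (1 - Real.exp (-r₀)) with hA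
  have hA0 : 0 < A := by positivity
  set h := Real.tanh (r₀ / 2) / 8 with hh
  have hh0 : 0 < h := by positivity
  set K := A * Real.exp β * Real.exp (α * h) / α with hK
  have hK0 : 0 ≤ K := by positivity
  have hexp : ∀ s t : ℝ, s ≤ t → Real.exp (-(α * t)) ≤ Real.exp (-(α * s)) := fun s t hst =>
    Real.exp_le_exp.2 (by nlinarith)
  refine ⟨K, hK0, fun γ L hγ hfar => ?_⟩
  have := kobayashiEDist_le_of_local (H := H) (γ := γ)
    (F := fun t => t + K * (1 - Real.exp (-(α * t)))) (L := L) (h := h) hh0 hγ.nonneg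
    (fun s _ t _ hst => by
      have := mul_le_mul_of_nonneg_left (hexp s t hst) hK0
      dsimp only
      linarith) fun s hs t ht hst hts => by
      refine (hγ.edist_le_of_far hGB hr₀ (le_max_left _ _) hs ht hst hts (hfar s hs)).trans
        (ENNReal.ofReal_le_ofReal ?_)
      have hu : 0 ≤ t - s := sub_nonneg.2 hst
      have e1 : Real.exp (-max r₀ (α * s - β)) ≤ Real.exp β * Real.exp (-(α * s)) := by
        rw [← Real.exp_add]
        exact Real.exp_le_exp.2 (by linarith [le_max_right r₀ (α * s - β)])
      have e2 : α * (t - s) * Real.exp (-(α * h)) ≤ 1 - Real.exp (-(α * (t - s))) := by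
        have e3 : α * (t - s) * Real.exp (-(α * h)) ≤
            α * (t - s) * Real.exp (-(α * (t - s))) := by
          refine mul_le_mul_of_nonneg_left (Real.exp_le_exp.2 ?_) (by positivity)
          nlinarith
        have e4 : (α * (t - s) + 1) * Real.exp (-(α * (t - s))) ≤ 1 := by
          rw [Real.exp_neg, ← div_eq_mul_inv, div_le_one (Real.exp_pos _)]
          exact Real.add_one_le_exp _
        linarith
      have e5 : Real.exp (-(α * t)) = Real.exp (-(α * s)) * Real.exp (-(α * (t - s))) := by
        rw [← Real.exp_add]; congr 1; ring
      have e6 : K * (α * (t - s) * Real.exp (-(α * h))) = A * Real.exp β * (t - s) := by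
        have : Real.exp (α * h) * Real.exp (-(α * h)) = 1 := by rw [← Real.exp_add]; simp
        have e0 : K * α = A * Real.exp β * Real.exp (α * h) := div_mul_cancel₀ _ hα.ne'
        linear_combination (t - s) * Real.exp (-(α * h)) * e0 + A * Real.exp β * (t - s) * this
      have e7 : A * Real.exp β * (t - s) ≤ K * (1 - Real.exp (-(α * (t - s)))) := by
        rw [← e6]
        exact mul_le_mul_of_nonneg_left e2 hK0
      have e8 := mul_le_mul_of_nonneg_left e7 (Real.exp_pos (-(α * s))).le
      have e9 := mul_le_mul_of_nonneg_left e1 (mul_nonneg hA0.le hu)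
      rw [e5]
      linarith
  refine this.trans (ENNReal.ofReal_le_ofReal ?_)
  have h2 := mul_nonneg hK0 (Real.exp_pos (-(α * L))).le
  simp only [mul_zero, neg_zero, Real.exp_zero, sub_self, add_zero, sub_zero]
  linarith

end Localization

/-- The Kobayashi distance as a real number. -/
noncomputable def kobayashiDist (D : Set (EuclideanSpace ℂ (Fin d)))
    (x y : EuclideanSpace ℂ (Fin d)) : ℝ :=
  (kobayashiEDist D x y).toReal

/-- Bounded complete hyperbolic domains. -/
structure IsBoundedHyperbolicDomain (D : Set (EuclideanSpace ℂ (Fin d))) : Prop where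
  isOpen : IsOpen D
  isConnected : IsConnected D
  isBounded : Bornology.IsBounded D
  isCompleteHyperbolic : IsCompleteHyperbolic D

theorem kobayashiDist_nonneg (D : Set (EuclideanSpace ℂ (Fin d)))
    (x y : EuclideanSpace ℂ (Fin d)) : 0 ≤ kobayashiDist D x y := ENNReal.toReal_nonneg

theorem kobayashiDist_comm (D : Set (EuclideanSpace ℂ (Fin d)))
    (x y : EuclideanSpace ℂ (Fin d)) : kobayashiDist D x y = kobayashiDist D y x := by
  rw [kobayashiDist, kobayashiEDist_comm, kobayashiDist]

theorem kobayashiDist_self (D : Set (EuclideanSpace ℂ (Fin d)))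
    (x : EuclideanSpace ℂ (Fin d)) : kobayashiDist D x x = 0 := by
  simp [kobayashiDist, kobayashiEDist_self]

theorem artanh_le_two_mul {x : ℝ} (h0 : 0 ≤ x) (h1 : x ≤ 1 / 2) : Real.artanh x ≤ 2 * x := by
  simpa using artanh_sub_artanh_le le_rfl h0 h1

theorem kobayashiEDist_le_of_dist_le {D : Set (EuclideanSpace ℂ (Fin d))}
    {x y : EuclideanSpace ℂ (Fin d)} {r : ℝ} (hr : 0 < r) (hball : Metric.ball x r ⊆ D)
    (hy : dist x y ≤ r / 2) : kobayashiEDist D x y ≤ ENNReal.ofReal (2 * (dist x y / r)) := by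
  refine (kobayashiEDist_le_of_ball_subset hr hball (by linarith)).trans
    (ENNReal.ofReal_le_ofReal (artanh_le_two_mul (by positivity) ?_))
  rw [div_le_iff₀ hr]
  linarith

theorem kobayashiEDist_ne_top {D : Set (EuclideanSpace ℂ (Fin d))} (hD : IsOpen D)
    (hc : IsPreconnected D) {x y : EuclideanSpace ℂ (Fin d)} (hx : x ∈ D) (hy : y ∈ D) :
    kobayashiEDist D x y ≠ ⊤ := by
  refine hc.induction₂ (fun x y => kobayashiEDist D x y ≠ ⊤) (fun x hx => ?_)
    (fun x y z _ _ _ h1 h2 => ne_top_of_le_ne_top (ENNReal.add_ne_top.2 ⟨h1, h2⟩)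
      (kobayashiEDist_triangle D x y z))
    (fun x y _ _ h => by rwa [kobayashiEDist_comm]) hx hy
  obtain ⟨r, hr, hball⟩ := Metric.isOpen_iff.1 hD x hx
  refine mem_nhdsWithin_of_mem_nhds ?_
  filter_upwards [Metric.closedBall_mem_nhds x (half_pos hr)] with y hy
  exact ne_top_of_le_ne_top ENNReal.ofReal_ne_top
    (kobayashiEDist_le_of_dist_le hr hball (by rwa [dist_comm]))

namespace IsBoundedHyperbolicDomain

variable {D : Set (EuclideanSpace ℂ (Fin d))}
  {x y z : EuclideanSpace ℂ (Fin d)}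

theorem edist_ne_top (hD : IsBoundedHyperbolicDomain D) (hx : x ∈ D) (hy : y ∈ D) :
    kobayashiEDist D x y ≠ ⊤ :=
  kobayashiEDist_ne_top hD.isOpen hD.isConnected.isPreconnected hx hy

theorem ofReal_dist (hD : IsBoundedHyperbolicDomain D) (hx : x ∈ D) (hy : y ∈ D) :
    ENNReal.ofReal (kobayashiDist D x y) = kobayashiEDist D x y :=
  ENNReal.ofReal_toReal (hD.edist_ne_top hx hy)

theorem ofReal_le_edist_iff (hD : IsBoundedHyperbolicDomain D) (hx : x ∈ D) (hy : y ∈ D) {r : ℝ} :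
    ENNReal.ofReal r ≤ kobayashiEDist D x y ↔ r ≤ kobayashiDist D x y := by
  rw [← hD.ofReal_dist hx hy, ENNReal.ofReal_le_ofReal_iff (kobayashiDist_nonneg _ _ _)]

theorem dist_triangle (hD : IsBoundedHyperbolicDomain D) (hx : x ∈ D) (hy : y ∈ D) (hz : z ∈ D) :
    kobayashiDist D x z ≤ kobayashiDist D x y + kobayashiDist D y z := by
  unfold kobayashiDist
  rw [← ENNReal.toReal_add (hD.edist_ne_top hx hy) (hD.edist_ne_top hy hz)]
  exact ENNReal.toReal_mono
    (ENNReal.add_ne_top.2 ⟨hD.edist_ne_top hx hy, hD.edist_ne_top hy hz⟩)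
    (kobayashiEDist_triangle D x y z)

theorem exists_mul_dist_le (hD : IsBoundedHyperbolicDomain D) :
    ∃ c : ℝ, 0 < c ∧ ∀ x ∈ D, ∀ y ∈ D, c * dist x y ≤ kobayashiDist D x y := by
  obtain ⟨c, hc, h⟩ := exists_mul_dist_le_kobayashiEDist hD.isBounded
  exact ⟨c, hc, fun x hx y hy => (hD.ofReal_le_edist_iff hx hy).1 (h x y)⟩

theorem exists_forall_dist_le (hD : IsBoundedHyperbolicDomain D)
    {K : Set (EuclideanSpace ℂ (Fin d))} (hK : IsCompact K) (hKD : K ⊆ D) (hx : x ∈ D) :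
    ∃ M : ℝ, ∀ k ∈ K, kobayashiDist D x k ≤ M := by
  refine hK.induction_on (p := fun s => ∃ M : ℝ, ∀ k ∈ s, kobayashiDist D x k ≤ M)
    ⟨0, by simp⟩ (fun s t hst ⟨M, hM⟩ => ⟨M, fun k hk => hM k (hst hk)⟩)
    (fun s t ⟨M, hM⟩ ⟨N, hN⟩ => ⟨max M N, fun k hk => ?_⟩) fun y hy => ?_
  · rcases hk with hk | hk
    · exact (hM k hk).trans (le_max_left _ _)
    · exact (hN k hk).trans (le_max_right _ _)
  · obtain ⟨r, hr, hball⟩ := Metric.isOpen_iff.1 hD.isOpen y (hKD hy)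
    refine ⟨Metric.closedBall y (r / 2),
      mem_nhdsWithin_of_mem_nhds (Metric.closedBall_mem_nhds y (half_pos hr)),
      kobayashiDist D x y + 1, fun k hk => ?_⟩
    rw [Metric.mem_closedBall, dist_comm] at hk
    have hkD : k ∈ D := hball (by rw [Metric.mem_ball, dist_comm]; linarith)
    refine (hD.dist_triangle hx (hKD hy) hkD).trans ?_
    have h1 := ENNReal.toReal_mono ENNReal.ofReal_ne_top (kobayashiEDist_le_of_dist_le hr hball hk)
    rw [ENNReal.toReal_ofReal (by positivity)] at h1
    have h2 : 2 * (dist y k / r) ≤ 1 := by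
      rw [mul_div_assoc', div_le_iff₀ hr]
      linarith
    have h3 : kobayashiDist D y k ≤ 1 := h1.trans h2
    linarith

/-- The metric space `(D, K_D)`. -/
noncomputable abbrev metricSpace (hD : IsBoundedHyperbolicDomain D) :
    MetricSpace (KobayashiSpace D) :=
  { PseudoEMetricSpace.toPseudoMetricSpace fun x y => hD.edist_ne_top x.mem y.mem with
    eq_of_dist_eq_zero := fun {x y} h => hD.isCompleteHyperbolic.1 x y
      (((ENNReal.toReal_eq_zero_iff _).1 h).resolve_right (hD.edist_ne_top x.mem y.mem)) }

theorem continuous_pt (hD : IsBoundedHyperbolicDomain D) :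
    Continuous (fun x : KobayashiSpace D => x.pt) := by
  let := hD.metricSpace
  obtain ⟨c, hc, h⟩ := hD.exists_mul_dist_le
  refine continuous_iff_continuousAt.2 fun x => Metric.continuousAt_iff.2 fun ε hε =>
    ⟨c * ε, by positivity, fun {y} hy => ?_⟩
  have h1 := h y.pt y.mem x.pt x.mem
  have h2 : kobayashiDist D y.pt x.pt < c * ε := hy
  exact lt_of_mul_lt_mul_left (h1.trans_lt h2) hc.le

theorem continuous_mk (hD : IsBoundedHyperbolicDomain D) :
    Continuous (fun x : D => (⟨x.1, x.2⟩ : KobayashiSpace D)) := by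
  let := hD.metricSpace
  refine continuous_iff_continuousAt.2 fun x => Metric.continuousAt_iff.2 fun ε hε => ?_
  obtain ⟨r, hr, hball⟩ := Metric.isOpen_iff.1 hD.isOpen x.1 x.2
  refine ⟨min (r / 2) (ε * r / 2), lt_min (by positivity) (by positivity), fun {y} hy => ?_⟩
  have hy1 : dist x.1 y.1 < min (r / 2) (ε * r / 2) := by rw [dist_comm]; exact hy
  have h1 := ENNReal.toReal_mono ENNReal.ofReal_ne_top
    (kobayashiEDist_le_of_dist_le hr hball (hy1.le.trans (min_le_left _ _)))
  rw [ENNReal.toReal_ofReal (by positivity)] at h1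
  have h2 : kobayashiDist D y.1 x.1 < ε := by
    rw [kobayashiDist_comm]
    refine lt_of_le_of_lt h1 ?_
    rw [mul_div_assoc', div_lt_iff₀ hr]
    linarith [hy1.trans_le (min_le_right _ _)]
  exact h2

theorem locallyCompactSpace (hD : IsBoundedHyperbolicDomain D) :
    LocallyCompactSpace (KobayashiSpace D) := by
  let e : D ≃ₜ KobayashiSpace D :=
    { toFun := fun x => ⟨x.1, x.2⟩
      invFun := fun x => ⟨x.pt, x.mem⟩
      left_inv := fun _ => rfl
      right_inv := fun _ => rfl
      continuous_toFun := hD.continuous_mk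
      continuous_invFun := hD.continuous_pt.subtype_mk _ }
  have : LocallyCompactSpace D := hD.isOpen.locallyCompactSpace
  exact e.symm.isOpenEmbedding.locallyCompactSpace

theorem hasShortPaths (hD : IsBoundedHyperbolicDomain D) :
    @HasShortPaths (KobayashiSpace D) hD.metricSpace := by
  let := hD.metricSpace
  intro x y M hM
  have hM' : kobayashiDist D x.pt y.pt < M := hM
  have hM0 : 0 < M := (kobayashiDist_nonneg _ _ _).trans_lt hM'
  obtain ⟨γ, h0, h1, hγD, hγ⟩ := joinedByShortPath_of_kobayashiEDist_lt (D := D) (x := x.pt)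
    (y := y.pt) (M := M) x.mem (by
      rw [← hD.ofReal_dist x.mem y.mem]
      exact (ENNReal.ofReal_lt_ofReal_iff hM0).2 hM')
  classical
  refine ⟨fun t => if h : t ∈ Icc 0 M then ⟨γ t, hγD t h⟩ else x, ?_, ?_, ?_⟩
  · ext1
    simp [hM0.le, h0]
  · ext1
    simp [hM0.le, h1]
  · intro s hs t ht
    simp only [dif_pos hs, dif_pos ht]
    have := ENNReal.toReal_mono ENNReal.ofReal_ne_top (hγ s hs t ht)
    rwa [ENNReal.toReal_ofReal (abs_nonneg _)] at this

theorem properSpace (hD : IsBoundedHyperbolicDomain D) :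
    @ProperSpace (KobayashiSpace D) hD.metricSpace.toPseudoMetricSpace := by
  let := hD.metricSpace
  have : CompleteSpace (KobayashiSpace D) := hD.isCompleteHyperbolic.2
  have : LocallyCompactSpace (KobayashiSpace D) := hD.locallyCompactSpace
  exact hD.hasShortPaths.properSpace

theorem isCompact_ball (hD : IsBoundedHyperbolicDomain D) (hx : x ∈ D) (M : ℝ) :
    IsCompact {z | z ∈ D ∧ kobayashiDist D x z ≤ M} := by
  let := hD.metricSpace
  have := hD.properSpace
  have h1 := (isCompact_closedBall (⟨x, hx⟩ : KobayashiSpace D) M).image hD.continuous_pt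
  convert h1 using 1
  ext z
  constructor
  · exact fun hz => ⟨⟨z, hz.1⟩, Metric.mem_closedBall'.2 hz.2, rfl⟩
  · rintro ⟨w, hw, rfl⟩
    exact ⟨w.mem, Metric.mem_closedBall'.1 hw⟩

theorem exists_geodesic (hD : IsBoundedHyperbolicDomain D) (hx : x ∈ D) (hy : y ∈ D) :
    ∃ γ, IsKobayashiGeodesic D γ (kobayashiDist D x y) ∧ γ 0 = x ∧
      γ (kobayashiDist D x y) = y := by
  let := hD.metricSpace
  have := hD.properSpace
  obtain ⟨γ, h0, h1, hγ⟩ := hD.hasShortPaths.exists_geodesic ⟨x, hx⟩ ⟨y, hy⟩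
  refine ⟨fun t => (γ t).pt, ⟨kobayashiDist_nonneg _ _ _, fun t _ => (γ t).mem,
    fun s hs t ht => ?_⟩, by simp [h0], congrArg KobayashiSpace.pt h1⟩
  rw [← hD.ofReal_dist (γ s).mem (γ t).mem]
  exact congrArg ENNReal.ofReal (hγ s hs t ht)

end IsBoundedHyperbolicDomain

namespace IsKobayashiGeodesic

variable {D : Set (EuclideanSpace ℂ (Fin d))} {γ : ℝ → EuclideanSpace ℂ (Fin d)} {L : ℝ}

theorem left_mem (hγ : IsKobayashiGeodesic D γ L) : γ 0 ∈ D := hγ.mem 0 ⟨le_rfl, hγ.nonneg⟩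

theorem right_mem (hγ : IsKobayashiGeodesic D γ L) : γ L ∈ D := hγ.mem L ⟨hγ.nonneg, le_rfl⟩

theorem dist_eq (hγ : IsKobayashiGeodesic D γ L) {s t : ℝ} (hs : s ∈ Icc 0 L) (ht : t ∈ Icc 0 L) :
    kobayashiDist D (γ s) (γ t) = |s - t| := by
  rw [kobayashiDist, hγ.edist_eq s hs t ht, ENNReal.toReal_ofReal (abs_nonneg _)]

theorem dist_left (hγ : IsKobayashiGeodesic D γ L) {t : ℝ} (ht : t ∈ Icc 0 L) :
    kobayashiDist D (γ 0) (γ t) = t := by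
  rw [hγ.dist_eq ⟨le_rfl, hγ.nonneg⟩ ht, zero_sub, abs_neg, abs_of_nonneg ht.1]

theorem dist_right (hγ : IsKobayashiGeodesic D γ L) {t : ℝ} (ht : t ∈ Icc 0 L) :
    kobayashiDist D (γ t) (γ L) = L - t := by
  rw [hγ.dist_eq ht ⟨hγ.nonneg, le_rfl⟩, abs_sub_comm, abs_of_nonneg (sub_nonneg.2 ht.2)]

theorem sub (hγ : IsKobayashiGeodesic D γ L) {a b : ℝ} (ha : 0 ≤ a) (hab : a ≤ b) (hb : b ≤ L) :
    IsKobayashiGeodesic D (fun t => γ (a + t)) (b - a) := by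
  have h : ∀ t ∈ Icc 0 (b - a), a + t ∈ Icc 0 L := fun t ht =>
    ⟨by linarith [ht.1], by linarith [ht.2]⟩
  refine ⟨by linarith, fun t ht => hγ.mem _ (h t ht), fun s hs t ht => ?_⟩
  rw [hγ.edist_eq _ (h s hs) _ (h t ht), add_sub_add_left_eq_sub]

theorem restrict (hγ : IsKobayashiGeodesic D γ L) {b : ℝ} (h0 : 0 ≤ b) (hb : b ≤ L) :
    IsKobayashiGeodesic D γ b := by
  simpa using hγ.sub le_rfl h0 hb

theorem reverse (hγ : IsKobayashiGeodesic D γ L) :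
    IsKobayashiGeodesic D (fun t => γ (L - t)) L := by
  have h : ∀ t ∈ Icc 0 L, L - t ∈ Icc 0 L := fun t ht =>
    ⟨by linarith [ht.2], by linarith [ht.1]⟩
  refine ⟨hγ.nonneg, fun t ht => hγ.mem _ (h t ht), fun s hs t ht => ?_⟩
  rw [hγ.edist_eq _ (h s hs) _ (h t ht), sub_sub_sub_cancel_left, abs_sub_comm]

theorem isGeodesicSegment (hγ : IsKobayashiGeodesic D γ L) :
    IsGeodesicSegment {w : KobayashiSpace D | ∃ t ∈ Icc 0 L, γ t = w.pt} ⟨γ 0, hγ.left_mem⟩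
      ⟨γ L, hγ.right_mem⟩ := by
  classical
  have h0 : (0 : ℝ) ∈ Icc 0 L := ⟨le_rfl, hγ.nonneg⟩
  have hL : L ∈ Icc 0 L := ⟨hγ.nonneg, le_rfl⟩
  refine ⟨L, fun t => if h : t ∈ Icc 0 L then ⟨γ t, hγ.mem t h⟩ else ⟨γ 0, hγ.left_mem⟩,
    hγ.nonneg, by simp [h0], by simp [hL], fun s hs t ht => ?_, ?_⟩
  · simp only [dif_pos hs, dif_pos ht]
    exact hγ.edist_eq s hs t ht
  · ext w
    constructor
    · rintro ⟨t, ht, hw⟩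
      refine ⟨t, ht, ?_⟩
      ext1
      simp only [dif_pos ht, hw]
    · rintro ⟨t, ht, rfl⟩
      exact ⟨t, ht, by simp only [dif_pos ht]⟩

theorem of_isGeodesicSegment {S : Set (KobayashiSpace D)} {x y : KobayashiSpace D}
    (h : IsGeodesicSegment S x y) : ∃ γ L, IsKobayashiGeodesic D γ L ∧ γ 0 = x.pt ∧ γ L = y.pt ∧
      ∀ t ∈ Icc 0 L, ∃ w ∈ S, w.pt = γ t := by
  obtain ⟨L, γ, hL, rfl, rfl, hγ, rfl⟩ := h
  exact ⟨fun t => (γ t).pt, L, ⟨hL, fun t _ => (γ t).mem, hγ⟩, rfl, rfl,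
    fun t ht => ⟨γ t, mem_image_of_mem γ ht, rfl⟩⟩

theorem continuousOn (hD : IsBoundedHyperbolicDomain D) (hγ : IsKobayashiGeodesic D γ L) :
    ContinuousOn γ (Icc 0 L) := by
  obtain ⟨c, hc, h⟩ := hD.exists_mul_dist_le
  refine Metric.continuousOn_iff.2 fun t ht ε hε => ⟨c * ε, by positivity, fun s hs hst => ?_⟩
  have h1 := h _ (hγ.mem s hs) _ (hγ.mem t ht)
  rw [hγ.dist_eq hs ht] at h1
  exact lt_of_mul_lt_mul_left (h1.trans_lt hst) hc.le

end IsKobayashiGeodesic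

theorem exists_first_crossing {f : ℝ → ℝ} {L ρ : ℝ} (hL : 0 ≤ L) (hf : ContinuousOn f (Icc 0 L))
    (h0 : f 0 ≤ ρ) (h1 : ρ ≤ f L) : ∃ τ ∈ Icc 0 L, f τ = ρ ∧ ∀ t ∈ Icc 0 τ, f t ≤ ρ := by
  have hS : IsCompact {t ∈ Icc 0 L | ρ ≤ f t} := by
    refine isCompact_Icc.of_isClosed_subset ?_ (sep_subset _ _)
    exact hf.preimage_isClosed_of_isClosed isClosed_Icc isClosed_Ici
  obtain ⟨τ, ⟨hτ, hρ⟩, hmin⟩ := hS.exists_isLeast ⟨L, ⟨hL, le_rfl⟩, h1⟩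
  have hsub : Icc 0 τ ⊆ Icc 0 L := Icc_subset_Icc_right hτ.2
  obtain ⟨t, ht, hft⟩ := intermediate_value_Icc hτ.1 (hf.mono hsub) ⟨h0, hρ⟩
  have : τ = t := le_antisymm (hmin ⟨hsub ht, hft.ge⟩) ht.2
  refine ⟨τ, hτ, this ▸ hft, fun s hs => ?_⟩
  rcases hs.2.eq_or_lt with rfl | hlt
  · exact (this ▸ hft).le
  · by_contra hcon
    exact absurd (hmin ⟨hsub hs, (not_le.1 hcon).le⟩) (not_le.2 hlt)

/-- Geodesics of `Ω ∩ V` with ends near a compact set of pairs of distinct points of a set in which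
the visibility condition holds meet a common compact set. -/
theorem exists_isCompact_meeting_geodesics {Ω V V' : Set (EuclideanSpace ℂ (Fin d))}
    (hΩ : IsOpen Ω) (hV : IsOpen V) (hVV : V' ⊆ V)
    (hvis : ∀ q₁ ∈ frontier Ω ∩ V', ∀ q₂ ∈ frontier Ω ∩ V', q₁ ≠ q₂ →
      HasVisibilityCondition (Ω ∩ V) q₁ q₂)
    {P : Set (EuclideanSpace ℂ (Fin d) × EuclideanSpace ℂ (Fin d))} (hP : IsCompact P)
    (hPV : ∀ q ∈ P, q.1 ∈ V' ∧ q.2 ∈ V' ∧ q.1 ≠ q.2) :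
    ∃ K, IsCompact K ∧ K ⊆ Ω ∩ V ∧ ∀ γ L, IsKobayashiGeodesic (Ω ∩ V) γ L →
      (γ 0, γ L) ∈ P → ∃ t ∈ Icc 0 L, γ t ∈ K := by
  refine hP.induction_on (p := fun s => ∃ K, IsCompact K ∧ K ⊆ Ω ∩ V ∧
    ∀ γ L, IsKobayashiGeodesic (Ω ∩ V) γ L → (γ 0, γ L) ∈ s → ∃ t ∈ Icc 0 L, γ t ∈ K)
    ⟨∅, isCompact_empty, empty_subset _, by simp⟩
    (fun s t hst ⟨K, hK, hKD, h⟩ => ⟨K, hK, hKD, fun γ L hγ hs => h γ L hγ (hst hs)⟩)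
    (fun s t ⟨K, hK, hKD, h⟩ ⟨K', hK', hKD', h'⟩ => ⟨K ∪ K', hK.union hK', union_subset hKD hKD',
      fun γ L hγ hs => ?_⟩) ?_
  · rcases hs with hs | hs
    · obtain ⟨t, ht, hk⟩ := h γ L hγ hs
      exact ⟨t, ht, Or.inl hk⟩
    · obtain ⟨t, ht, hk⟩ := h' γ L hγ hs
      exact ⟨t, ht, Or.inr hk⟩
  rintro ⟨a, b⟩ hab
  obtain ⟨ha, hb, hne⟩ := hPV _ hab
  have hopen : IsOpen (Ω ∩ V) := hΩ.inter hV
  by_cases haΩ : a ∈ Ω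
  · obtain ⟨K, hK, haK, hKD⟩ := exists_compact_subset hopen ⟨haΩ, hVV ha⟩
    refine ⟨Prod.fst ⁻¹' K, mem_nhdsWithin_of_mem_nhds
      (continuousAt_fst.preimage_mem_nhds (mem_interior_iff_mem_nhds.1 haK)), K, hK, hKD,
      fun γ L hγ hs => ⟨0, ⟨le_rfl, hγ.nonneg⟩, hs⟩⟩
  by_cases hbΩ : b ∈ Ω
  · obtain ⟨K, hK, hbK, hKD⟩ := exists_compact_subset hopen ⟨hbΩ, hVV hb⟩
    refine ⟨Prod.snd ⁻¹' K, mem_nhdsWithin_of_mem_nhds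
      (continuousAt_snd.preimage_mem_nhds (mem_interior_iff_mem_nhds.1 hbK)), K, hK, hKD,
      fun γ L hγ hs => ⟨L, ⟨hγ.nonneg, le_rfl⟩, hs⟩⟩
  by_cases hac : a ∈ closure Ω
  · by_cases hbc : b ∈ closure Ω
    · have hfr : ∀ q, q ∈ closure Ω → q ∉ Ω → q ∈ frontier Ω := fun q h1 h2 =>
        ⟨h1, by rwa [hΩ.interior_eq]⟩
      obtain ⟨Va, hVa, Vb, hVb, K, hK, hKD, -, h⟩ :=
        hvis a ⟨hfr a hac haΩ, ha⟩ b ⟨hfr b hbc hbΩ, hb⟩ hne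
      refine ⟨Va ×ˢ Vb, mem_nhdsWithin_of_mem_nhds (prod_mem_nhds hVa hVb), K, hK, hKD,
        fun γ L hγ hs => ?_⟩
      obtain ⟨w, ⟨t, ht, hw⟩, hwK⟩ := h _ _ hs.1 hs.2 _ hγ.isGeodesicSegment
      exact ⟨t, ht, hw ▸ hwK⟩
    · refine ⟨Prod.snd ⁻¹' (closure Ω)ᶜ, mem_nhdsWithin_of_mem_nhds
        (continuousAt_snd.preimage_mem_nhds (isClosed_closure.isOpen_compl.mem_nhds hbc)), ∅,
        isCompact_empty, empty_subset _, fun γ L hγ hs => ?_⟩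
      exact absurd (subset_closure hγ.right_mem.1) hs
  · refine ⟨Prod.fst ⁻¹' (closure Ω)ᶜ, mem_nhdsWithin_of_mem_nhds
      (continuousAt_fst.preimage_mem_nhds (isClosed_closure.isOpen_compl.mem_nhds hac)), ∅,
      isCompact_empty, empty_subset _, fun γ L hγ hs => ?_⟩
    exact absurd (subset_closure hγ.left_mem.1) hs

variable {D D' : Set (EuclideanSpace ℂ (Fin d))} {o p : EuclideanSpace ℂ (Fin d)}

theorem kobayashiDist_le_of_edist_le {x y : EuclideanSpace ℂ (Fin d)} {r : ℝ}
    (hr : 0 ≤ r) (h : kobayashiEDist D x y ≤ ENNReal.ofReal r) : kobayashiDist D x y ≤ r := by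
  have := ENNReal.toReal_mono ENNReal.ofReal_ne_top h
  rwa [ENNReal.toReal_ofReal hr] at this

/-- In a Gromov hyperbolic domain, a geodesic starting at an almost nearest point to `o` moves away
from `o` at unit speed, up to an additive constant. -/
theorem IsBoundedHyperbolicDomain.exists_dist_add_sub_le (hD : IsBoundedHyperbolicDomain D)
    (hG : IsGromovHyperbolic (KobayashiSpace D)) :
    ∃ C : ℝ, ∀ o ∈ D, ∀ σ ℓ, IsKobayashiGeodesic D σ ℓ →
      (∀ t ∈ Icc 0 ℓ, kobayashiDist D o (σ 0) ≤ kobayashiDist D o (σ t) + 1) →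
      ∀ t ∈ Icc 0 ℓ, kobayashiDist D o (σ 0) + t - C ≤ kobayashiDist D o (σ t) := by
  obtain ⟨δ, hδ, hthin⟩ := hG
  refine ⟨6 * δ + 6, fun o ho σ ℓ hσ hmin t ht => ?_⟩
  have hc : σ 0 ∈ D := hσ.left_mem
  have he : σ t ∈ D := hσ.mem t ht
  have hct : kobayashiDist D (σ 0) (σ t) = t := hσ.dist_left ht
  by_cases hL : kobayashiDist D o (σ 0) ≤ 2 * δ + 2
  · have := hD.dist_triangle hc ho he
    rw [kobayashiDist_comm D (σ 0) o] at this
    linarith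
  push Not at hL
  obtain ⟨α, hα, hα0, hα1⟩ := hD.exists_geodesic ho hc
  obtain ⟨β, hβ, hβ0, hβ1⟩ := hD.exists_geodesic he ho
  set L := kobayashiDist D o (σ 0) with hLdef
  have hs : L - (2 * δ + 2) ∈ Icc 0 L := ⟨by linarith, by linarith⟩
  set u := α (L - (2 * δ + 2)) with hu
  have huD : u ∈ D := hα.mem _ hs
  have hou : kobayashiDist D o u = L - (2 * δ + 2) := by rw [← hα.dist_left hs, hα0]
  have huc : kobayashiDist D u (σ 0) = 2 * δ + 2 := by
    rw [← hα1, hα.dist_right hs]; ring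
  have hα' := hα.isGeodesicSegment
  have hσ' := (hσ.restrict ht.1 ht.2).isGeodesicSegment
  have hβ' := hβ.isGeodesicSegment
  simp only [hα0, hα1, hβ0, hβ1] at hα' hβ'
  have h1 := hthin _ _ _ _ _ _ hα' hσ' hβ' ⟨u, huD⟩ ⟨_, hs, rfl⟩
  have h2 : Metric.infEDist (⟨u, huD⟩ : KobayashiSpace D) _ < ENNReal.ofReal (δ + 1) :=
    h1.trans_lt ((ENNReal.ofReal_lt_ofReal_iff (by linarith)).2 (by linarith))
  obtain ⟨v, hv, huv⟩ := Metric.infEDist_lt_iff.1 h2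
  have huv' : kobayashiDist D u v.pt < δ + 1 := by
    have h3 : kobayashiEDist D u v.pt < ENNReal.ofReal (δ + 1) := huv
    rwa [← hD.ofReal_dist huD v.mem, ENNReal.ofReal_lt_ofReal_iff (by linarith)] at h3
  rcases hv with ⟨s, hs, hsv⟩ | ⟨s, hs, hsv⟩
  · have h3 := hmin s ⟨hs.1, hs.2.trans ht.2⟩
    rw [hsv] at h3
    have h4 := hD.dist_triangle ho huD v.mem
    linarith
  · have h3 := hβ.dist_left hs
    have h4 := hβ.dist_right hs
    rw [hsv, hβ0] at h3
    rw [hsv, hβ1] at h4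
    have h5 := hD.dist_triangle he v.mem huD
    have h6 := hD.dist_triangle he huD hc
    have h7 := hD.dist_triangle huD v.mem ho
    rw [kobayashiDist_comm D v.pt u] at h5
    rw [kobayashiDist_comm D (σ t) (σ 0)] at h6
    rw [kobayashiDist_comm D u o] at h7
    rw [kobayashiDist_comm D o (σ t)]
    linarith

/-- The geodesics of `D` from the closed ball of radius `r` around `p` to the sphere of radius `R`
meet a common compact set. -/
def HasCompactBarrier (D : Set (EuclideanSpace ℂ (Fin d))) (p : EuclideanSpace ℂ (Fin d))
    (r R : ℝ) : Prop :=
  ∃ K, IsCompact K ∧ K ⊆ D ∧ ∀ γ L, IsKobayashiGeodesic D γ L → dist (γ 0) p ≤ r →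
    dist (γ L) p = R → ∃ t ∈ Icc 0 L, γ t ∈ K

theorem IsKobayashiGeodesic.exists_first_exit (hD : IsBoundedHyperbolicDomain D)
    {γ : ℝ → EuclideanSpace ℂ (Fin d)} {L r : ℝ} (hγ : IsKobayashiGeodesic D γ L)
    (p : EuclideanSpace ℂ (Fin d)) (h0 : dist (γ 0) p ≤ r) (h1 : r ≤ dist (γ L) p) :
    ∃ τ ∈ Icc 0 L, dist (γ τ) p = r ∧ ∀ t ∈ Icc 0 τ, dist (γ t) p ≤ r :=
  exists_first_crossing (f := fun t => dist (γ t) p) hγ.nonneg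
    ((continuous_id.dist continuous_const).comp_continuousOn (hγ.continuousOn hD)) h0 h1

theorem IsBoundedHyperbolicDomain.exists_dist_sub_le_of_barrier (hD : IsBoundedHyperbolicDomain D)
    (ho : o ∈ D) {r R : ℝ} (hrR : r ≤ R) (hb : HasCompactBarrier D p r R) :
    ∃ M : ℝ, ∀ z ∈ D, dist z p ≤ r → ∀ w ∈ D, R ≤ dist w p →
      kobayashiDist D o z - M ≤ kobayashiDist D z w := by
  obtain ⟨K, hK, hKD, h⟩ := hb
  obtain ⟨M, hM⟩ := hD.exists_forall_dist_le hK hKD ho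
  refine ⟨M, fun z hz hzr w hw hwR => ?_⟩
  obtain ⟨γ, hγ, h0, h1⟩ := hD.exists_geodesic hz hw
  obtain ⟨τ, hτ, hτR, -⟩ := hγ.exists_first_exit (r := R) hD p (by rw [h0]; exact hzr.trans hrR)
    (by rw [h1]; exact hwR)
  obtain ⟨t, ht, htK⟩ := h γ τ (hγ.restrict hτ.1 hτ.2) (by rwa [h0]) hτR
  have ht' : t ∈ Icc 0 (kobayashiDist D z w) := ⟨ht.1, ht.2.trans hτ.2⟩
  have h2 := hγ.dist_left ht'
  rw [h0] at h2
  have h3 := hD.dist_triangle ho (hKD htK) hz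
  rw [kobayashiDist_comm D (γ t) z] at h3
  linarith [hM _ htK, ht'.2]

theorem IsBoundedHyperbolicDomain.exists_pos_le_dist (hD : IsBoundedHyperbolicDomain D)
    (p : EuclideanSpace ℂ (Fin d)) {r R : ℝ} (hrR : r < R) :
    ∃ r₀ : ℝ, 0 < r₀ ∧ ∀ z ∈ D, dist z p ≤ r → ∀ w ∈ D \ Metric.ball p R,
      r₀ ≤ kobayashiDist D z w := by
  obtain ⟨c, hc, h⟩ := hD.exists_mul_dist_le
  refine ⟨c * (R - r), mul_pos hc (by linarith), fun z hz hzr w hw => ?_⟩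
  refine le_trans (mul_le_mul_of_nonneg_left ?_ hc.le) (h z hz w hw.1)
  have h1 := not_lt.1 (fun h => hw.2 (Metric.mem_ball.2 h))
  linarith [dist_triangle_left w p z]

/-- Near a point where geodesics of `D'` bend inside, `K_D ≤ K_{D'} + C`. -/
theorem exists_dist_le_dist_add (hD : IsBoundedHyperbolicDomain D)
    (hD' : IsBoundedHyperbolicDomain D') (ho : o ∈ D) (ho' : o ∈ D') {r₁ r₂ r₃ : ℝ}
    (h12 : r₁ ≤ r₂) (h23 : r₂ < r₃) (hsub : D' ∩ Metric.ball p r₃ ⊆ D)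
    (hb₁ : HasCompactBarrier D' p r₁ r₂) (hb₂ : HasCompactBarrier D' p r₂ r₃) :
    ∃ C : ℝ, ∀ z ∈ D', dist z p ≤ r₁ → kobayashiDist D o z ≤ kobayashiDist D' o z + C := by
  obtain ⟨M₂, hM₂⟩ := hD'.exists_dist_sub_le_of_barrier ho' h23.le hb₂
  obtain ⟨K, hK, hKD', hmeet⟩ := hb₁
  have hmem : ∀ z ∈ D', dist z p ≤ r₂ → z ∈ D := fun z hz hzr =>
    hsub ⟨hz, Metric.mem_ball.2 (hzr.trans_lt h23)⟩
  obtain ⟨N', hN'⟩ := hD'.exists_forall_dist_le hK hKD' ho'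
  obtain ⟨N, hN⟩ := hD.exists_forall_dist_le (hK.inter_right (Metric.isClosed_closedBall))
    (fun z hz => hmem z (hKD' hz.1) (Metric.mem_closedBall.1 hz.2)) ho
  obtain ⟨r₀, hr₀, hfar⟩ := hD'.exists_pos_le_dist p h23
  obtain ⟨C, hC, hlen⟩ := exists_kobayashiEDist_le_length_add hsub hr₀ one_pos (max 0 N' + M₂)
  refine ⟨max 0 N + max 0 N' + C, fun z hz hzr => ?_⟩
  obtain ⟨γ, hγ, h0, h1⟩ := hD'.exists_geodesic hz ho'
  set L := kobayashiDist D' z o with hL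
  obtain ⟨τ, hτ, hτr, hk⟩ : ∃ τ ∈ Icc 0 L, (∀ t ∈ Icc 0 τ, dist (γ t) p ≤ r₂) ∧
      (γ τ = o ∨ γ τ ∈ K) := by
    by_cases hin : ∀ t ∈ Icc 0 L, dist (γ t) p ≤ r₂
    · exact ⟨L, ⟨hγ.nonneg, le_rfl⟩, hin, Or.inl h1⟩
    · push Not at hin
      obtain ⟨s, hs, hsr⟩ := hin
      have hγs := hγ.restrict hs.1 hs.2
      obtain ⟨τ, hτ, hτr, hin⟩ := hγs.exists_first_exit hD' p (by rw [h0]; exact hzr.trans h12)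
        hsr.le
      obtain ⟨t, ht, htK⟩ := hmeet γ τ (hγs.restrict hτ.1 hτ.2) (by rwa [h0]) hτr
      exact ⟨t, ⟨ht.1, ht.2.trans (hτ.2.trans hs.2)⟩,
        fun s hs => hin s ⟨hs.1, hs.2.trans ht.2⟩, Or.inr htK⟩
  have hkD' : γ τ ∈ D' := hγ.mem τ hτ
  have hkr : dist (γ τ) p ≤ r₂ := hτr τ ⟨hτ.1, le_rfl⟩
  have hkD : γ τ ∈ D := hmem _ hkD' hkr
  have hok' : kobayashiDist D' o (γ τ) ≤ max 0 N' := by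
    rcases hk with hk | hk
    · rw [hk, kobayashiDist_self]; exact le_max_left _ _
    · exact (hN' _ hk).trans (le_max_right _ _)
  have hok : kobayashiDist D o (γ τ) ≤ max 0 N := by
    rcases hk with hk | hk
    · rw [hk, kobayashiDist_self]; exact le_max_left _ _
    · exact (hN _ ⟨hk, hkr⟩).trans (le_max_right _ _)
  have hσ := (hγ.restrict hτ.1 hτ.2).reverse
  have h2 := hlen _ _ hσ fun t ht w hw => by
    have htD := hσ.mem t ht
    have htr : dist (γ (τ - t)) p ≤ r₂ := hτr _ ⟨by linarith [ht.2], by linarith [ht.1]⟩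
    rw [hD'.ofReal_le_edist_iff htD hw.1]
    refine max_le (hfar _ htD htr w hw) ?_
    have h3 := hM₂ _ htD htr w hw.1 (not_lt.1 fun h => hw.2 (Metric.mem_ball.2 h))
    have h4 := hσ.dist_left ht
    have h5 := hD'.dist_triangle hkD' ho' htD
    simp only [sub_zero] at h4
    rw [kobayashiDist_comm D' (γ τ) o] at h5
    linarith
  simp only [sub_zero, sub_self, h0] at h2
  have h3 := kobayashiDist_le_of_edist_le (by linarith [hτ.1]) h2
  have h4 := hγ.dist_left hτ
  rw [h0] at h4
  have h5 := hD'.dist_triangle hz ho' hkD'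
  have h6 := hD.dist_triangle ho hkD (hmem z hz (hzr.trans h12))
  rw [kobayashiDist_comm D' z o] at h5
  linarith

/-- The `K_D`-distance from a point near `p` to the complement of a ball is at least comparable with
the distance to the base point. -/
theorem exists_mul_dist_sub_le (hD : IsBoundedHyperbolicDomain D)
    (hD' : IsBoundedHyperbolicDomain D') (ho' : o ∈ D') {r₁ r₂ r₃ C₀ : ℝ}
    (h12 : r₁ ≤ r₂) (h23 : r₂ < r₃) (hsub : D ∩ Metric.ball p r₃ ⊆ D')
    (hb : HasCompactBarrier D' p r₁ r₂)
    (hC₀ : ∀ z ∈ D', dist z p ≤ r₁ → kobayashiDist D o z ≤ kobayashiDist D' o z + C₀) :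
    ∃ c C : ℝ, 0 < c ∧ ∀ z ∈ D, dist z p ≤ r₁ → ∀ w ∈ D, r₂ ≤ dist w p →
      c * kobayashiDist D o z - C ≤ kobayashiDist D z w := by
  obtain ⟨M, hM⟩ := hD'.exists_dist_sub_le_of_barrier ho' h12 hb
  obtain ⟨r₀, hr₀, hfar⟩ := hD.exists_pos_le_dist p h23
  obtain ⟨C₁, hC₁, hlen⟩ := exists_kobayashiEDist_le_mul_length hsub hr₀
  refine ⟨1 / C₁, (C₀ + M) / C₁, by positivity, fun z hz hzr w hw hwr => ?_⟩
  have hmem : ∀ z ∈ D, dist z p ≤ r₂ → z ∈ D' := fun z hz hzr =>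
    hsub ⟨hz, Metric.mem_ball.2 (hzr.trans_lt h23)⟩
  obtain ⟨γ, hγ, h0, h1⟩ := hD.exists_geodesic hz hw
  obtain ⟨τ, hτ, hτr, hin⟩ := hγ.exists_first_exit (r := r₂) hD p (by rw [h0]; exact hzr.trans h12)
    (by rwa [h1])
  have hγτ := hγ.restrict hτ.1 hτ.2
  have h2 := kobayashiDist_le_of_edist_le (mul_nonneg hC₁.le hτ.1)
    (hlen γ τ hγτ fun t ht w hw =>
      (hD.ofReal_le_edist_iff (hγτ.mem t ht) hw.1).2 (hfar _ (hγτ.mem t ht) (hin t ht) w hw))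
  rw [h0] at h2
  have hzD' := hmem z hz (hzr.trans h12)
  have h3 := hM z hzD' hzr (γ τ) (hmem _ hγτ.right_mem hτr.le) hτr.ge
  have h4 := hC₀ z hzD' hzr
  rw [one_div_mul_eq_div, ← sub_div, div_le_iff₀ hC₁]
  nlinarith [hτ.2]

/-- A geodesic of the Gromov hyperbolic domain `D` that stays near `p`, and whose ends are joined by
geodesics of `D'` through a fixed compact set, cannot have its whole length far from `o`. -/
theorem exists_dist_le_of_almost_nearest (hD : IsBoundedHyperbolicDomain D)
    (hD' : IsBoundedHyperbolicDomain D') (hG : IsGromovHyperbolic (KobayashiSpace D))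
    (ho : o ∈ D) (ho' : o ∈ D') {r₁ r₂ r₃ : ℝ}
    (h12 : r₁ ≤ r₂) (h23 : r₂ < r₃) (hsub : D ∩ Metric.ball p r₃ ⊆ D')
    (hsub' : D' ∩ Metric.ball p r₃ ⊆ D)
    (hb₁ : HasCompactBarrier D' p r₁ r₂) (hb₂ : HasCompactBarrier D' p r₂ r₃)
    {P : Set (EuclideanSpace ℂ (Fin d) × EuclideanSpace ℂ (Fin d))}
    (hP : ∃ K, IsCompact K ∧ K ⊆ D' ∧ ∀ γ L, IsKobayashiGeodesic D' γ L →
      (γ 0, γ L) ∈ P → ∃ t ∈ Icc 0 L, γ t ∈ K) :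
    ∃ M : ℝ, ∀ σ ℓ, IsKobayashiGeodesic D σ ℓ → (∀ t ∈ Icc 0 ℓ, dist (σ t) p ≤ r₁) →
      (∀ t ∈ Icc 0 ℓ, kobayashiDist D o (σ 0) ≤ kobayashiDist D o (σ t) + 1) →
      (σ 0, σ ℓ) ∈ P → kobayashiDist D o (σ 0) ≤ M := by
  obtain ⟨C₃, hC₃⟩ := exists_dist_le_dist_add hD hD' ho ho' h12 h23 hsub' hb₁ hb₂
  obtain ⟨c, C₄, hc, hC₄⟩ := exists_mul_dist_sub_le hD hD' ho' h12 h23 hsub hb₁ hC₃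
  obtain ⟨C₅, hC₅⟩ := hD.exists_dist_add_sub_le hG
  obtain ⟨r₀, hr₀, hfar⟩ := hD.exists_pos_le_dist p (h12.trans_lt h23)
  obtain ⟨C₆, hC₆, hlen⟩ := exists_kobayashiEDist_le_length_add hsub hr₀ hc (c * C₅ + C₄)
  obtain ⟨K, hK, hKD', hmeet⟩ := hP
  obtain ⟨N, hN⟩ := hD'.exists_forall_dist_le hK hKD' ho'
  refine ⟨(C₆ + 2 * C₃ + 2 * N + C₅) / 2, fun σ ℓ hσ hin hmin hends => ?_⟩
  have hmem : ∀ t ∈ Icc 0 ℓ, σ t ∈ D' := fun t ht =>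
    hsub ⟨hσ.mem t ht, Metric.mem_ball.2 ((hin t ht).trans_lt (h12.trans_lt h23))⟩
  have h0 : (0 : ℝ) ∈ Icc 0 ℓ := ⟨le_rfl, hσ.nonneg⟩
  have hℓ : ℓ ∈ Icc 0 ℓ := ⟨hσ.nonneg, le_rfl⟩
  have hgrow := hC₅ o ho σ ℓ hσ hmin
  have h1 := kobayashiDist_le_of_edist_le (by linarith [hσ.nonneg])
    (hlen σ ℓ hσ fun t ht w hw => by
      rw [hD.ofReal_le_edist_iff (hσ.mem t ht) hw.1]
      refine max_le (hfar _ (hσ.mem t ht) (hin t ht) w hw) ?_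
      have h2 := hC₄ _ (hσ.mem t ht) (hin t ht) w hw.1
        (h23.le.trans (not_lt.1 fun h => hw.2 (Metric.mem_ball.2 h)))
      have h3 := mul_le_mul_of_nonneg_left (hgrow t ht) hc.le
      have h4 := mul_nonneg hc.le (kobayashiDist_nonneg D o (σ 0))
      linarith)
  obtain ⟨γ, hγ, hγ0, hγ1⟩ := hD'.exists_geodesic (hmem 0 h0) (hmem ℓ hℓ)
  obtain ⟨t, ht, htK⟩ := hmeet γ _ hγ (by rwa [hγ0, hγ1])
  have h2 := hγ.dist_left ht
  have h3 := hγ.dist_right ht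
  rw [hγ0] at h2
  rw [hγ1] at h3
  have h4 := hD'.dist_triangle ho' (hKD' htK) (hmem 0 h0)
  have h5 := hD'.dist_triangle ho' (hKD' htK) (hmem ℓ hℓ)
  rw [kobayashiDist_comm D' (γ t) (σ 0)] at h4
  have h6 := hC₃ _ (hmem 0 h0) (hin 0 h0)
  have h7 := hC₃ _ (hmem ℓ hℓ) (hin ℓ hℓ)
  linarith [hN _ htK, hgrow ℓ hℓ]

theorem exists_almost_min {f : ℝ → ℝ} (hf : ∀ t, 0 ≤ f t) {τ : ℝ} (hτ : 0 ≤ τ) :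
    ∃ s ∈ Icc 0 τ, ∀ t ∈ Icc 0 τ, f s ≤ f t + 1 := by
  have hne : (f '' Icc 0 τ).Nonempty := ⟨_, mem_image_of_mem f ⟨le_rfl, hτ⟩⟩
  obtain ⟨_, ⟨s, hs, rfl⟩, hlt⟩ := exists_lt_of_csInf_lt hne (lt_add_one (sInf (f '' Icc 0 τ)))
  refine ⟨s, hs, fun t ht => ?_⟩
  have := csInf_le ⟨0, by rintro _ ⟨t, -, rfl⟩; exact hf t⟩ (mem_image_of_mem f ht)
  linarith

/-- Geodesics of `D` that cross a spherical shell around `q` come close to `o`, if the almost nearest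
points to `o` on short geodesics do. -/
theorem exists_dist_le_of_crossing (hD : IsBoundedHyperbolicDomain D)
    {q : EuclideanSpace ℂ (Fin d)} {r η M : ℝ}
    (hη : 0 < η) (hball : Metric.closedBall q η ⊆ Metric.closedBall p r)
    (hM : ∀ σ ℓ, IsKobayashiGeodesic D σ ℓ → (∀ t ∈ Icc 0 ℓ, dist (σ t) p ≤ r) →
      (∀ t ∈ Icc 0 ℓ, kobayashiDist D o (σ 0) ≤ kobayashiDist D o (σ t) + 1) →
      (σ 0, σ ℓ) ∈ {x : EuclideanSpace ℂ (Fin d) × EuclideanSpace ℂ (Fin d) |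
        x.1 ∈ Metric.closedBall q η ∧ x.2 ∈ Metric.closedBall q η ∧ 3 * η / 8 ≤ dist x.1 x.2} →
      kobayashiDist D o (σ 0) ≤ M)
    {σ : ℝ → EuclideanSpace ℂ (Fin d)} {L : ℝ} (hσ : IsKobayashiGeodesic D σ L)
    (h0 : dist (σ 0) q ≤ η / 4) (h1 : η ≤ dist (σ L) q) :
    ∃ t ∈ Icc 0 L, kobayashiDist D o (σ t) ≤ M := by
  obtain ⟨τ, hτ, hτη, hin⟩ := hσ.exists_first_exit hD q (h0.trans (by linarith)) h1
  obtain ⟨s, hs, hmin⟩ := exists_almost_min (f := fun t => kobayashiDist D o (σ t))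
    (fun t => kobayashiDist_nonneg _ _ _) hτ.1
  refine ⟨s, ⟨hs.1, hs.2.trans hτ.2⟩, ?_⟩
  have hin' : ∀ t ∈ Icc 0 τ, dist (σ t) p ≤ r := fun t ht => hball (hin t ht)
  have h0τ : (0 : ℝ) ∈ Icc 0 τ := ⟨le_rfl, hτ.1⟩
  have hττ : τ ∈ Icc 0 τ := ⟨hτ.1, le_rfl⟩
  by_cases hfar : 3 * η / 8 ≤ dist (σ s) (σ τ)
  · have hsub : ∀ t ∈ Icc 0 (τ - s), s + t ∈ Icc 0 τ := fun t ht =>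
      ⟨by linarith [hs.1, ht.1], by linarith [ht.2]⟩
    have := hM _ _ (hσ.sub hs.1 hs.2 hτ.2) (fun t ht => hin' _ (hsub t ht))
      (fun t ht => by simpa using hmin _ (hsub t ht))
      (by simpa using ⟨hin s hs, hin τ hττ, hfar⟩)
    simpa using this
  · have hsub : ∀ t ∈ Icc 0 s, s - t ∈ Icc 0 τ := fun t ht =>
      ⟨by linarith [ht.2], by linarith [hs.2, ht.1]⟩
    have hfar' : 3 * η / 8 ≤ dist (σ s) (σ 0) := by
      have h2 := dist_triangle (σ τ) (σ s) q
      have h3 := dist_triangle (σ s) (σ 0) q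
      rw [dist_comm (σ τ) (σ s)] at h2
      linarith
    have := hM _ _ (hσ.restrict hs.1 (hs.2.trans hτ.2)).reverse (fun t ht => hin' _ (hsub t ht))
      (fun t ht => by simpa using hmin _ (hsub t ht))
      (by simpa using ⟨hin s hs, hin 0 h0τ, hfar'⟩)
    simpa using this

theorem frontier_inter_inter_subset {X : Type*} [TopologicalSpace X] {Ω U : Set X} (hΩ : IsOpen Ω)
    (hU : IsOpen U) : frontier (Ω ∩ U) ∩ U ⊆ frontier Ω := by
  rintro q ⟨⟨hq, hq'⟩, hqU⟩
  rw [(hΩ.inter hU).interior_eq] at hq'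
  refine ⟨closure_mono inter_subset_left hq, ?_⟩
  rw [hΩ.interior_eq]
  exact fun h => hq' ⟨h, hqU⟩

theorem IsLocallyVisibleAt.isVisibilityNeighborhood {Ω U : Set (EuclideanSpace ℂ (Fin d))}
    (hΩopen : IsOpen Ω) (hΩbdd : Bornology.IsBounded Ω) (hp : p ∈ frontier Ω)
    (hUopen : IsOpen U) (hpU : p ∈ U)
    (hUconn : IsConnected (Ω ∩ U)) (hUcomplete : IsCompleteHyperbolic (Ω ∩ U))
    (hUGromov : IsGromovHyperbolic (KobayashiSpace (Ω ∩ U)))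
    (hvis : IsLocallyVisibleAt Ω p) : IsVisibilityNeighborhood Ω p U := by
  obtain ⟨V, hVopen, hpV, hVconn, hVcomplete, V', hV'open, hpV', hVV, hvis⟩ := hvis
  have hD : IsBoundedHyperbolicDomain (Ω ∩ U) :=
    ⟨hΩopen.inter hUopen, hUconn, hΩbdd.subset inter_subset_left, hUcomplete⟩
  have hD' : IsBoundedHyperbolicDomain (Ω ∩ V) :=
    ⟨hΩopen.inter hVopen, hVconn, hΩbdd.subset inter_subset_left, hVcomplete⟩
  obtain ⟨r₃, hr₃, hball⟩ := Metric.nhds_basis_closedBall.mem_iff.1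
    ((hUopen.inter hV'open).mem_nhds ⟨hpU, hpV'⟩)
  set r₁ := r₃ / 3 with hr₁
  set r₂ := 2 * r₃ / 3 with hr₂
  have hr₁0 : 0 < r₁ := by positivity
  have h12 : r₁ < r₂ := by rw [hr₁, hr₂]; linarith
  have h23 : r₂ < r₃ := by rw [hr₂]; linarith
  have hcb : ∀ z, dist z p ≤ r₃ → z ∈ U ∧ z ∈ V' := fun z hz => hball hz
  have hsub : Ω ∩ U ∩ Metric.ball p r₃ ⊆ Ω ∩ V := fun z hz =>
    ⟨hz.1.1, hVV (hcb z (Metric.mem_ball.1 hz.2).le).2⟩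
  have hsub' : Ω ∩ V ∩ Metric.ball p r₃ ⊆ Ω ∩ U := fun z hz =>
    ⟨hz.1.1, (hcb z (Metric.mem_ball.1 hz.2).le).1⟩
  have hbarrier : ∀ r R : ℝ, r < R → R ≤ r₃ → HasCompactBarrier (Ω ∩ V) p r R := by
    intro r R hrR hR
    obtain ⟨K, hK, hKD, h⟩ := exists_isCompact_meeting_geodesics hΩopen hVopen hVV hvis
      ((isCompact_closedBall p r).prod (isCompact_sphere p R)) fun q hq => by
        have h1 : dist q.1 p ≤ r := hq.1
        have h2 : dist q.2 p = R := hq.2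
        refine ⟨(hcb _ (by linarith)).2, (hcb _ (by linarith)).2, fun h => ?_⟩
        rw [h] at h1
        linarith
    exact ⟨K, hK, hKD, fun γ L hγ h0 h1 => h γ L hγ ⟨h0, h1⟩⟩
  obtain ⟨o, hoΩ, hop⟩ := Metric.mem_closure_iff.1 hp.1 r₁ hr₁0
  rw [dist_comm] at hop
  have hoU := (hcb o (by linarith)).1
  have hoV := hVV (hcb o (by linarith)).2
  refine ⟨hUopen, hpU, hUconn, hUcomplete, Metric.ball p (r₁ / 2), Metric.isOpen_ball,
    Metric.mem_ball_self (by positivity),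
    fun z hz => (hcb z (by have := Metric.mem_ball.1 hz; linarith)).1, ?_⟩
  rintro q₁ ⟨-, hq₁⟩ q₂ - hne
  have hdist : 0 < dist q₁ q₂ := dist_pos.2 hne
  obtain ⟨η, hη, hη1, hη2⟩ : ∃ η, 0 < η ∧ η ≤ dist q₁ q₂ / 2 ∧ η ≤ r₁ / 2 :=
    ⟨min (dist q₁ q₂ / 2) (r₁ / 2), lt_min (by positivity) (by positivity), min_le_left _ _,
      min_le_right _ _⟩
  have hηball : Metric.closedBall q₁ η ⊆ Metric.closedBall p r₁ :=
    Metric.closedBall_subset_closedBall' (by linarith [Metric.mem_ball.1 hq₁])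
  have hPc : IsCompact {x : EuclideanSpace ℂ (Fin d) × EuclideanSpace ℂ (Fin d) |
      x.1 ∈ Metric.closedBall q₁ η ∧ x.2 ∈ Metric.closedBall q₁ η ∧
        3 * η / 8 ≤ dist x.1 x.2} := by
    refine ((isCompact_closedBall q₁ η).prod (isCompact_closedBall q₁ η)).of_isClosed_subset ?_
      fun x hx => ⟨hx.1, hx.2.1⟩
    exact (Metric.isClosed_closedBall.preimage continuous_fst).inter
      ((Metric.isClosed_closedBall.preimage continuous_snd).inter
        (isClosed_le continuous_const (continuous_fst.dist continuous_snd)))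
  obtain ⟨M, hM⟩ := exists_dist_le_of_almost_nearest hD hD' hUGromov ⟨hoΩ, hoU⟩ ⟨hoΩ, hoV⟩ h12.le
    h23 hsub hsub' (hbarrier r₁ r₂ h12 h23.le) (hbarrier r₂ r₃ h23 le_rfl)
    (exists_isCompact_meeting_geodesics hΩopen hVopen hVV hvis hPc fun x hx => by
      have h1 : dist x.1 p ≤ r₁ := hηball hx.1
      have h2 : dist x.2 p ≤ r₁ := hηball hx.2.1
      refine ⟨(hcb _ (by linarith)).2, (hcb _ (by linarith)).2, fun h => ?_⟩
      have h3 := hx.2.2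
      rw [h, dist_self] at h3
      linarith)
  refine ⟨Metric.ball q₁ (η / 4), Metric.ball_mem_nhds _ (by positivity), Metric.ball q₂ (η / 4),
    Metric.ball_mem_nhds _ (by positivity), _, hD.isCompact_ball ⟨hoΩ, hoU⟩ M, fun z hz => hz.1,
    Metric.ball_disjoint_ball (by linarith), fun x y hx hy S hS => ?_⟩
  obtain ⟨σ, L, hσ, h0, h1, hσS⟩ := IsKobayashiGeodesic.of_isGeodesicSegment hS
  obtain ⟨t, ht, htM⟩ := exists_dist_le_of_crossing hD hη hηball hM hσ
    (by rw [h0]; exact (Metric.mem_ball.1 hx).le)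
    (by
      rw [h1]
      have h2 := Metric.mem_ball.1 hy
      have h3 := dist_triangle_left q₁ q₂ y.pt
      linarith)
  obtain ⟨w, hwS, hw⟩ := hσS t ht
  exact ⟨w, hwS, w.mem, hw ▸ htM⟩

theorem IsVisibilityNeighborhood.isLocallyVisibleAt_inter
    {Ω U : Set (EuclideanSpace ℂ (Fin d))} (hΩ : IsOpen Ω)
    (h : IsVisibilityNeighborhood Ω p U) : IsLocallyVisibleAt (Ω ∩ U) p := by
  obtain ⟨hU, hpU, hconn, hcomp, U', hU', hpU', hUU, hvis⟩ := h
  have e : Ω ∩ U ∩ U = Ω ∩ U := by rw [inter_assoc, inter_self]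
  have hfr : frontier (Ω ∩ U) ∩ U' ⊆ frontier Ω ∩ U' := fun q hq =>
    ⟨frontier_inter_inter_subset hΩ hU ⟨hq.1, hUU hq.2⟩, hq.2⟩
  refine ⟨U, hU, hpU, by rwa [e], by rwa [e], U', hU', hpU', hUU, fun q₁ h₁ q₂ h₂ hne => ?_⟩
  rw [e]
  exact hvis q₁ (hfr h₁) q₂ (hfr h₂) hne

theorem lemma2p3 {d : ℕ} (Ω : Set (EuclideanSpace ℂ (Fin d)))
    (hΩopen : IsOpen Ω) (hΩconn : IsConnected Ω) (hΩbdd : Bornology.IsBounded Ω)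
    (p : EuclideanSpace ℂ (Fin d)) (hp : p ∈ frontier Ω)
    (U : Set (EuclideanSpace ℂ (Fin d))) (hUopen : IsOpen U) (hpU : p ∈ U)
    (hUconn : IsConnected (Ω ∩ U)) (hUcomplete : IsCompleteHyperbolic (Ω ∩ U))
    (hUGromov : IsGromovHyperbolic (KobayashiSpace (Ω ∩ U)))
    (hvis : IsLocallyVisibleAt Ω p) :
    IsLocallyVisibleAt (Ω ∩ U) p ∧ IsVisibilityNeighborhood Ω p U := by
  have h := hvis.isVisibilityNeighborhood hΩopen hΩbdd hp hUopen hpU hUconn hUcomplete hUGromov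
  exact ⟨h.isLocallyVisibleAt_inter hΩopen, h⟩
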